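/- **Model.** UAVs at height $h_v\ge 0$ project to a homogeneous Poisson point process of density $\lambda>0$ on $\mathbb R^2$, ranked by distance to the origin: $\|v_1\|<\|v_2\|<\cdots$. The typical BS is above the origin at height $h_b\ge 0$. Put $\Delta h=|h_v-h_b|$, $r_1=\|v_1\|$, and $\gamma(r)=\lfloor r\sqrt{\beta_a\beta_b}\rfloor$ with $\beta_a,\beta_b>0$. A link of horizontal length $r$ is LOS ($\kappa=L$) with probability $p_L(\gamma(r))$ and otherwise NLOS ($\kappa=N$), $p_N=1-p_L$, where $p_L(0)=1$ and, for $k\ge1$ and a fixed $\varepsilon>0$, $$p_L(k)=\prod_{n=0}^{k}\Bigl(1-\exp\Bigl(-\frac{(k\max(h_v,h_b)-(n+\frac12)\Delta h)^2}{2\varepsilon^2k^2}\Bigr)\Bigr).$$ A link in state $\kappa$ has path loss $C_\kappa(r^2+\Delta h^2)^{-\alpha_\kappa/2}$, with $C_\kappa>0$ and $\alpha_\kappa\ge 2$, and squared fading amplitude $|\hat h|^2$ that is Gamma distributed with shape and rate $\mathcal N_\kappa\in\{1,2,\dots\}$. With beamwidths $\theta^a_c\in[0,2\pi]$, $\theta^e_c\in[0,\pi]$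 and gains $M_c,m_c\ge0$ ($c\in\{t,r\}$), put $q_c=\frac{\theta_c^a}{2\pi}\frac{\theta_c^e}{\pi}$. The directivity gain $G$ of an interferer equals $o_i$ with probability $p_i$, where $(o_1,\dots,o_4)=(M_tM_r,\,m_tM_r,\,M_tm_r,\,m_tm_r)$ and $(p_1,\dots,p_4)=(q_tq_r,\,(1-q_t)q_r,\,q_t(1-q_r),\,(1-q_t)(1-q_r))$. Given all positions, the marks (state, gain, fading) of different interferers are independent; for one interferer, the gain is independent of the state and the fading. Let $I=\sum_{n\ge2}(\text{path loss}\times G\times|\hat h|^2)_{v_n}\in[0,\infty]$. **Claim.** For every $s\ge0$, almost surely $$\mathbb E\bigl[e^{-sI}\,\big|\,r_1\bigr]=\exp\Bigl(-2\pi\lambda\sum_{i=1}^4p_i\bigl(\Theta^L(s,o_i|r_1)+\Theta^N(s,o_i|r_1)\bigr)\Bigr),$$ where, with $\gamma=\gamma(r_1)$, $$\Theta^\kappa(s,o|r_1)=p_\kappa(\gamma)\,Z^\kappa\Bigl(s,r_1,\tfrac{\gamma+1}{\sqrt{\beta_a\beta_b}},o\Bigr)+\sum_{j=\gamma+1}^\infty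 p_\kappa(j)\,Z^\kappa\Bigl(s,\tfrac{j}{\sqrt{\beta_a\beta_b}},\tfrac{j+1}{\sqrt{\beta_a\beta_b}},o\Bigr),$$ $$Z^\kappa(s,a,b,o)=\frac{a^2+\Delta h^2}{2}F^\kappa_{\alpha_\kappa}\Bigl(\frac{sC_\kappa o}{\mathcal N_\kappa(a^2+\Delta h^2)^{\alpha_\kappa/2}}\Bigr)-\frac{b^2+\Delta h^2}{2}F^\kappa_{\alpha_\kappa}\Bigl(\frac{sC_\kappa o}{\mathcal N_\kappa(b^2+\Delta h^2)^{\alpha_\kappa/2}}\Bigr).$$ For $\alpha_\kappa>2$, $F^\kappa_{\alpha_\kappa}(z)={}_2F_1\bigl(-\frac2{\alpha_\kappa},\mathcal N_\kappa;1-\frac2{\alpha_\kappa};-z\bigr)-1$, with ${}_2F_1$ the Gauss hypergeometric function (continued analytically to $\mathbb C\setminus[1,\infty)$). For $\alpha_\kappa=2$, $$F_2^\kappa(z)=\sum_{c=1}^{\mathcal N_\kappa-1}\frac{z\,\mathcal N_\kappa}{(z+1)^{\mathcal N_\kappa-c}(\mathcal N_\kappa-c)}+\frac{1-(z+1)^{\mathcal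 N_\kappa-1}}{(z+1)^{\mathcal N_\kappa-1}}-z\,\mathcal N_\kappa\ln\Bigl(1+\frac1z\Bigr)\quad(z>0),\qquad F_2^\kappa(0)=0.$$ For every $r_1>0$ the series in $\Theta^L$ converges, and so does the series in $\Theta^N$ if $\alpha_N>2$. If $\alpha_N=2$, the series in $\Theta^N$ may diverge to $+\infty$; the right-hand side is then read as the limit obtained from the partial sums of the series (that is, $e^{-\infty}=0$, with $e^{-s\cdot\infty}=0$ for $s>0$ and $=1$ for $s=0$ on the left). -/

import Mathlib

open MeasureTheory ProbabilityTheory Filter Topology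
open scoped ENNReal NNReal

/-- The state of a link: `L` is line of sight (LOS), `N` is non line of sight (NLOS). -/
inductive Link : Type
  | L : Link
  | N : Link

instance : MeasurableSpace Link := ⊤

/-! ### Poisson point processes -/

/-- The random measure `Φ` is a Poisson point process with intensity measure `Λ`: the number of
points in a set of finite intensity is Poisson distributed with that mean, and the numbers of
points in pairwise disjoint sets are independent. -/
structure IsPoissonPointProcess {Ω E : Type*} [MeasurableSpace Ω] [MeasurableSpace E]
    (μ : Measure Ω) (Φ : Ω → Measure E) (Λ : Measure E) : Prop where
  measurable_count : ∀ A : Set E, MeasurableSet A → Measurable fun ω => Φ ω A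
  count_law : ∀ A : Set E, MeasurableSet A → Λ A < ∞ →
    μ.map (fun ω => Φ ω A) = (poissonMeasure (Λ A).toNNReal).map (fun k : ℕ => (k : ℝ≥0∞))
  count_indep : ∀ (m : ℕ) (A : Fin m → Set E), (∀ i, MeasurableSet (A i)) →
    (Pairwise fun i j => Disjoint (A i) (A j)) → iIndepFun (fun i ω => Φ ω (A i)) μ

/-! ### Parameters of the downlink network -/

structure DownlinkParams where
  /-- density of the UAVs -/
  lam : ℝ
  /-- height of the UAVs -/
  hv : ℝ
  /-- height of the BSs -/
  hb : ℝ
  /-- ratio of the obstacle area to the total area -/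
  betaA : ℝ
  /-- density of the obstacles -/
  betaB : ℝ
  /-- scale of the Rayleigh distributed obstacle heights -/
  eps : ℝ
  /-- intercepts -/
  C : Link → ℝ
  /-- path loss exponents -/
  α : Link → ℝ
  /-- Nakagami fading parameters -/
  Nak : Link → ℕ
  /-- half-power beamwidths: transmitter / receiver (`t` / `r`), azimuth / elevation (`a` / `e`) -/
  θta : ℝ
  θte : ℝ
  θra : ℝ
  θre : ℝ
  /-- main beam gains -/
  Mt : ℝ
  Mr : ℝ
  /-- side lobe gains -/
  mt : ℝ
  mr : ℝ

namespace DownlinkParams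

/-- The physically meaningful ranges of the parameters. -/
structure Admissible (P : DownlinkParams) : Prop where
  lam_pos : 0 < P.lam
  hv_nonneg : 0 ≤ P.hv
  hb_nonneg : 0 ≤ P.hb
  betaA_pos : 0 < P.betaA
  betaB_pos : 0 < P.betaB
  eps_pos : 0 < P.eps
  C_pos : ∀ κ, 0 < P.C κ
  Nak_pos : ∀ κ, 1 ≤ P.Nak κ
  θta_mem : P.θta ∈ Set.Icc 0 (2 * Real.pi)
  θte_mem : P.θte ∈ Set.Icc 0 Real.pi
  θra_mem : P.θra ∈ Set.Icc 0 (2 * Real.pi)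
  θre_mem : P.θre ∈ Set.Icc 0 Real.pi
  Mt_nonneg : 0 ≤ P.Mt
  Mr_nonneg : 0 ≤ P.Mr
  mt_nonneg : 0 ≤ P.mt
  mr_nonneg : 0 ≤ P.mr

noncomputable section

variable (P : DownlinkParams)

/-- The height difference between UAVs and BSs. -/
def dh : ℝ := |P.hv - P.hb|

/-- The number `√(β_a β_b)` of obstacles met per unit length. -/
def rate : ℝ := √(P.betaA * P.betaB)

/-- `γ(r) = ⌊r √(β_a β_b)⌋`. -/
def γ (r : ℝ) : ℕ := ⌊r * P.rate⌋₊

/-- The probability of a LOS link, as a function of `k = γ(r)`. For `k = 0` (no obstacle between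
the two ends) the exponent in the general expression is `-(⋯) / 0 = -∞`, so the value is `1`. -/
def losProb (k : ℕ) : ℝ :=
  if k = 0 then 1 else
    ∏ n ∈ Finset.range (k + 1),
      (1 - Real.exp (-((k * max P.hv P.hb - (n + 1 / 2) * P.dh) ^ 2
        / (2 * P.eps ^ 2 * (k : ℝ) ^ 2))))

/-- The probability `p_κ(k)` that a link with `γ(r) = k` is in the state `κ`. -/
def linkProb : Link → ℕ → ℝ
  | Link.L, k => P.losProb k
  | Link.N, k => 1 - P.losProb k

/-- The path loss at horizontal distance `r` of a link in the state `κ`. -/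
def pathLoss (κ : Link) (r : ℝ) : ℝ :=
  P.C κ / √((r ^ 2 + P.dh ^ 2) ^ P.α κ)

/-- The probability that a transmitter, resp. receiver, points its main beam. -/
def qt : ℝ := P.θta / (2 * Real.pi) * (P.θte / Real.pi)
def qr : ℝ := P.θra / (2 * Real.pi) * (P.θre / Real.pi)

/-- The four directivity gains `o_i`. -/
def gain : Fin 4 → ℝ :=
  ![P.Mt * P.Mr, P.mt * P.Mr, P.Mt * P.mr, P.mt * P.mr]

/-- The probabilities `p_i` of the four directivity gains. -/
def gainProb : Fin 4 → ℝ :=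
  ![P.qt * P.qr, (1 - P.qt) * P.qr, P.qt * (1 - P.qr), (1 - P.qt) * (1 - P.qr)]

end

end DownlinkParams

/-! ### The downlink network -/

/-- The downlink network on a probability space, seen from the typical BS at the origin.
* `v 0, v 1, …` are the UAVs, ranked by their distance to the origin; they form a homogeneous
  Poisson point process on the plane. The UAV `v 0` is the serving one; the interferers are
  `v 1, v 2, …`.
* `link n`, `pat n`, `fad n` are the link state, the gain pattern and the squared fading amplitude
  of the interferer `v (n + 1)`. Given all positions, these marks are independent over `n`; the
  link state is `κ` with probability `p_κ(γ(‖v (n + 1)‖))`, the pattern is `i` with probability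
  `p_i` independently of the state, and the squared fading amplitude of a link in the state `κ` is
  a normalized Gamma variable with parameter `N_κ`. -/
structure IsDownlinkNetwork {Ω : Type*} [MeasurableSpace Ω] (μ : Measure Ω) (P : DownlinkParams)
    (v : ℕ → Ω → EuclideanSpace ℝ (Fin 2)) (link : ℕ → Ω → Link) (pat : ℕ → Ω → Fin 4)
    (fad : ℕ → Ω → ℝ) : Prop where
  measurable_v : ∀ n, Measurable (v n)
  measurable_link : ∀ n, Measurable (link n)
  measurable_pat : ∀ n, Measurable (pat n)
  measurable_fad : ∀ n, Measurable (fad n)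
  ranked : ∀ᵐ ω ∂μ, StrictMono fun n => ‖v n ω‖
  poisson : IsPoissonPointProcess μ (fun ω => Measure.sum fun n => Measure.dirac (v n ω))
    (ENNReal.ofReal P.lam • volume)
  marks : ∀ (B : Set (ℕ → EuclideanSpace ℝ (Fin 2))), MeasurableSet B →
    ∀ (S : Finset ℕ) (κ : ℕ → Link) (i : ℕ → Fin 4) (T : ℕ → Set ℝ),
      (∀ n, MeasurableSet (T n)) →
      μ {ω | (fun n => v n ω) ∈ B ∧ ∀ n ∈ S, link n ω = κ n ∧ pat n ω = i n ∧ fad n ω ∈ T n} =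
        ∫⁻ ω in {ω | (fun n => v n ω) ∈ B},
          ∏ n ∈ S, ENNReal.ofReal (P.linkProb (κ n) (P.γ ‖v (n + 1) ω‖)) *
            ENNReal.ofReal (P.gainProb (i n)) *
            gammaMeasure (P.Nak (κ n)) (P.Nak (κ n)) (T n) ∂μ

noncomputable section

/-- The received power of interference: the sum over all UAVs except the nearest one of
path loss × directivity gain × squared fading amplitude (possibly `∞`). -/
def interference {Ω : Type*} (P : DownlinkParams) (v : ℕ → Ω → EuclideanSpace ℝ (Fin 2))
    (link : ℕ → Ω → Link) (pat : ℕ → Ω → Fin 4) (fad : ℕ → Ω → ℝ) (ω : Ω) : ℝ≥0∞ :=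
  ∑' n, ENNReal.ofReal
    (P.pathLoss (link n ω) ‖v (n + 1) ω‖ * P.gain (pat n ω) * fad n ω)

/-- `exp (-x)` for `x ∈ [0, ∞]`, with `exp (-∞) = 0`. -/
def expNeg (x : ℝ≥0∞) : ℝ := if x = ∞ then 0 else Real.exp (-x.toReal)

/-- The σ-algebra generated by the distance `r₁` of the nearest UAV. -/
@[reducible] def nearestSigma {Ω : Type*} (v : ℕ → Ω → EuclideanSpace ℝ (Fin 2)) : MeasurableSpace Ω :=
  MeasurableSpace.comap (fun ω => ‖v 0 ω‖) inferInstance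

/-- The conditional Laplace transform `E[exp (-s I) | r₁]` of the interference. -/
def condLaplace {Ω : Type*} [MeasurableSpace Ω] (μ : Measure Ω) (P : DownlinkParams)
    (v : ℕ → Ω → EuclideanSpace ℝ (Fin 2)) (link : ℕ → Ω → Link) (pat : ℕ → Ω → Fin 4)
    (fad : ℕ → Ω → ℝ) (s : ℝ) : Ω → ℝ :=
  condExp (nearestSigma v) μ
    (fun ω => expNeg (ENNReal.ofReal s * interference P v link pat fad ω))

/-! ### The Gauss hypergeometric function and the closed forms -/

/-- `f` is the holomorphic continuation of the hypergeometric series with parameters `a, b; c`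
from the unit disc to the plane cut along `[1, ∞)`. -/
def IsHypergeometricContinuation (a b c : ℂ) (f : ℂ → ℂ) : Prop :=
  DifferentiableOn ℂ f {z | 1 - z ∈ Complex.slitPlane} ∧
    Set.EqOn f (fun z => ordinaryHypergeometric a b c z) (Metric.ball 0 1)

open Classical in
/-- The Gauss hypergeometric function `₂F₁(a, b; c; z)` on the cut plane. -/
def gaussHypergeometric (a b c z : ℂ) : ℂ :=
  if h : ∃ f, IsHypergeometricContinuation a b c f then h.choose z else 0

/-- `F_α` for `α > 2` (and Nakagami parameter `N`). -/
def FGeneric (α : ℝ) (N : ℕ) (z : ℝ) : ℝ :=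
  (gaussHypergeometric ((-2 / α : ℝ) : ℂ) (N : ℂ) ((1 - 2 / α : ℝ) : ℂ) ((-z : ℝ) : ℂ)).re - 1

/-- `F_α` for `α = 2`; the sum over `c` is empty for `N = 1`. -/
def FTwo (N : ℕ) (z : ℝ) : ℝ :=
  ∑ c ∈ Finset.Icc 1 (N - 1), z * N / ((z + 1) ^ (N - c) * ((N : ℝ) - c))
    + (1 - (z + 1) ^ (N - 1)) / (z + 1) ^ (N - 1)
    - z * N * Real.log (1 + 1 / z)

/-- The function `F_α`, for `α ≥ 2`. -/
def FAlpha (α : ℝ) (N : ℕ) (z : ℝ) : ℝ :=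
  if α = 2 then FTwo N z else FGeneric α N z

namespace DownlinkParams

variable (P : DownlinkParams)

/-- One of the two terms whose difference is `Z^κ`. -/
def ZPart (κ : Link) (s a g : ℝ) : ℝ :=
  (a ^ 2 + P.dh ^ 2) / 2 *
    FAlpha (P.α κ) (P.Nak κ) (s * P.C κ * g / (P.Nak κ * (a ^ 2 + P.dh ^ 2) ^ (P.α κ / 2)))

/-- `Z^κ(s, a, b, g)`. -/
def Z (κ : Link) (s a b g : ℝ) : ℝ := P.ZPart κ s a g - P.ZPart κ s b g

/-- The contribution to `Θ^κ` of the annulus that contains `r₁`. -/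
def thetaHead (κ : Link) (s g r₁ : ℝ) : ℝ :=
  P.linkProb κ (P.γ r₁) * P.Z κ s r₁ ((P.γ r₁ + 1) / P.rate) g

/-- The contribution to `Θ^κ` of the `j`-th annulus. -/
def thetaTerm (κ : Link) (s g : ℝ) (j : ℕ) : ℝ :=
  P.linkProb κ j * P.Z κ s (j / P.rate) ((j + 1) / P.rate) g

/-- `Θ^κ(s, g | r₁)`; the series runs over the annuli `j = γ(r₁) + 1 + m`, `m = 0, 1, …`. -/
def Theta (κ : Link) (s g r₁ : ℝ) : ℝ :=
  P.thetaHead κ s g r₁ + ∑' m : ℕ, P.thetaTerm κ s g (P.γ r₁ + 1 + m)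

/-- `Θ^κ(s, g | r₁)` with the series cut off after `J` annuli. -/
def ThetaPartial (J : ℕ) (κ : Link) (s g r₁ : ℝ) : ℝ :=
  P.thetaHead κ s g r₁ + ∑ m ∈ Finset.range J, P.thetaTerm κ s g (P.γ r₁ + 1 + m)

end DownlinkParams

end

/-!
Conditionally on the position `r₁` of the nearest point, the other points of the process form a
Poisson process outside the disc of radius `r₁`. The marks being conditionally independent, the
fading integrates out to the factor `markLaplace s ‖x‖` for each interferer `x`, so the Laplace
functional of the Poisson process gives
`E[exp (-s I) | r₁] = exp (-λ ∫_{‖x‖ > r₁} (1 - markLaplace s ‖x‖) dx)`.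
In polar coordinates this is an integral over `r > r₁`, and on each interval where `γ` is constant
the integrand has an explicit antiderivative in terms of `F_α`, whose increments are the `Z^κ`.
The exponential `exp (-x)` takes values in `[0, 1] ⊆ ℝ≥0∞` throughout, so that no integrability
questions arise before the last step.
-/

/-- The map `x ↦ exp (-x)` of `[0, ∞]` into itself, i.e. `expNeg` with values in `ℝ≥0∞`, so that
expectations of Laplace functionals are Lebesgue integrals without integrability side conditions. -/
noncomputable def eexpNeg (x : ℝ≥0∞) : ℝ≥0∞ := EReal.exp (-(x : EReal))

/-- The inverse of `eexpNeg` on `[0, 1]`; values above `1` are sent to `0`. -/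
noncomputable def enegLog (m : ℝ≥0∞) : ℝ≥0∞ := (-ENNReal.log m).toENNReal

theorem eexpNeg_ofReal {x : ℝ} (hx : 0 ≤ x) :
    eexpNeg (ENNReal.ofReal x) = ENNReal.ofReal (Real.exp (-x)) := by
  rw [eexpNeg, EReal.coe_ennreal_ofReal, max_eq_left hx, ← EReal.coe_neg, EReal.exp_coe]

@[simp] theorem eexpNeg_zero : eexpNeg 0 = 1 := by simp [eexpNeg]

@[simp] theorem eexpNeg_top : eexpNeg ∞ = 0 := by simp [eexpNeg]

theorem toReal_eexpNeg (x : ℝ≥0∞) : (eexpNeg x).toReal = expNeg x := by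
  by_cases hx : x = ∞
  · simp [expNeg, hx]
  · conv_lhs => rw [← ENNReal.ofReal_toReal hx]
    rw [eexpNeg_ofReal ENNReal.toReal_nonneg, ENNReal.toReal_ofReal (Real.exp_pos _).le, expNeg,
      if_neg hx]

theorem antitone_eexpNeg : Antitone eexpNeg := fun _ _ hxy =>
  EReal.exp_monotone (EReal.neg_le_neg_iff.2 (EReal.coe_ennreal_le_coe_ennreal_iff.2 hxy))

theorem eexpNeg_le_one (x : ℝ≥0∞) : eexpNeg x ≤ 1 :=
  eexpNeg_zero ▸ antitone_eexpNeg zero_le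

theorem eexpNeg_ne_top (x : ℝ≥0∞) : eexpNeg x ≠ ∞ :=
  ne_top_of_le_ne_top ENNReal.one_ne_top (eexpNeg_le_one x)

theorem continuous_eexpNeg : Continuous eexpNeg :=
  ENNReal.continuous_exp.comp (continuous_neg.comp continuous_coe_ennreal_ereal)

@[fun_prop] theorem measurable_eexpNeg : Measurable eexpNeg := continuous_eexpNeg.measurable

theorem eexpNeg_add (x y : ℝ≥0∞) : eexpNeg (x + y) = eexpNeg x * eexpNeg y := by
  rw [eexpNeg, EReal.coe_ennreal_add, EReal.neg_add (by simp) (by simp), sub_eq_add_neg,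
    EReal.exp_add]
  rfl

theorem eexpNeg_sum {ι : Type*} (S : Finset ι) (x : ι → ℝ≥0∞) :
    eexpNeg (∑ i ∈ S, x i) = ∏ i ∈ S, eexpNeg (x i) := by
  induction S using Finset.cons_induction with
  | empty => simp
  | cons a S ha ih => rw [Finset.sum_cons, Finset.prod_cons, eexpNeg_add, ih]

theorem eexpNeg_natCast_mul (k : ℕ) (x : ℝ≥0∞) : eexpNeg (k * x) = eexpNeg x ^ k := by
  simpa using eexpNeg_sum (Finset.range k) fun _ => x

theorem eexpNeg_enegLog {m : ℝ≥0∞} (hm : m ≤ 1) : eexpNeg (enegLog m) = m := by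
  have hlog : 0 ≤ -ENNReal.log m := by
    rw [EReal.le_neg, neg_zero, ← ENNReal.log_one]
    exact ENNReal.log_monotone hm
  rw [eexpNeg, enegLog, EReal.coe_toENNReal hlog, neg_neg, ENNReal.exp_log]

@[fun_prop] theorem measurable_enegLog : Measurable enegLog :=
  (measurable_ereal_toENNReal.comp measurable_neg).comp ENNReal.measurable_log

theorem tendsto_eexpNeg_tsum (x : ℕ → ℝ≥0∞) :
    Tendsto (fun n => ∏ i ∈ Finset.range n, eexpNeg (x i)) atTop (𝓝 (eexpNeg (∑' n, x n))) := by
  simp_rw [← eexpNeg_sum]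
  exact (continuous_eexpNeg.tendsto _).comp (ENNReal.tendsto_nat_tsum x)

section BoundedConvergence

variable {Ω : Type*} [MeasurableSpace Ω] {μ : Measure Ω} [IsFiniteMeasure μ]

theorem tendsto_lintegral_of_le_one {F : ℕ → Ω → ℝ≥0∞} {G : Ω → ℝ≥0∞}
    (hF : ∀ n, Measurable (F n)) (hle : ∀ n ω, F n ω ≤ 1)
    (hlim : ∀ᵐ ω ∂μ, Tendsto (fun n => F n ω) atTop (𝓝 (G ω))) :
    Tendsto (fun n => ∫⁻ ω, F n ω ∂μ) atTop (𝓝 (∫⁻ ω, G ω ∂μ)) :=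
  tendsto_lintegral_of_dominated_convergence (fun _ => 1) hF (fun n => ae_of_all _ (hle n))
    (by simp) hlim

theorem integrable_expNeg {X : Ω → ℝ≥0∞} (hX : Measurable X) :
    Integrable (fun ω => expNeg (X ω)) μ := by
  simp_rw [← toReal_eexpNeg]
  refine integrable_toReal_of_lintegral_ne_top (by fun_prop) ?_
  exact ne_top_of_le_ne_top (by simp) (lintegral_mono fun ω => eexpNeg_le_one (X ω))

end BoundedConvergence

theorem integral_expNeg {Ω : Type*} [MeasurableSpace Ω] {μ : Measure Ω}
    {X : Ω → ℝ≥0∞} (hX : Measurable X) :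
    ∫ ω, expNeg (X ω) ∂μ = (∫⁻ ω, eexpNeg (X ω) ∂μ).toReal := by
  simp_rw [← toReal_eexpNeg]
  exact integral_toReal (by fun_prop) (ae_of_all _ fun ω => (eexpNeg_ne_top _).lt_top)

/-! ### The Laplace functional of a Poisson point process -/

theorem lintegral_pow_poissonMeasure (r : ℝ≥0) {z : ℝ≥0∞} (hz : z ≤ 1) :
    ∫⁻ k, z ^ k ∂poissonMeasure r = eexpNeg (r * (1 - z)) := by
  lift z to ℝ≥0 using ne_top_of_le_ne_top ENNReal.one_ne_top hz
  have hz' : (z : ℝ) ≤ 1 := by exact_mod_cast hz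
  have hterm (n : ℕ) : (z : ℝ≥0∞) ^ n * poissonMeasure r {n} =
      ENNReal.ofReal (Real.exp (-r) * ((r * z : ℝ) ^ n / n.factorial)) := by
    rw [poissonMeasure_singleton, ← ENNReal.ofReal_coe_nnreal, ← ENNReal.ofReal_pow z.coe_nonneg,
      ← ENNReal.ofReal_mul (by positivity)]
    ring_nf
  have hsum : HasSum (fun n : ℕ => Real.exp (-r) * ((r * z : ℝ) ^ n / n.factorial))
      (Real.exp (-(r * (1 - z)))) := by
    have h := (NormedSpace.expSeries_div_hasSum_exp (r * z : ℝ)).mul_left (Real.exp (-r))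
    rwa [← Real.exp_eq_exp_ℝ, ← Real.exp_add,
      show (-r + r * z : ℝ) = -(r * (1 - z)) by ring] at h
  have hexponent : (r * (1 - z) : ℝ≥0∞) = ENNReal.ofReal (r * (1 - z)) := by
    rw [ENNReal.ofReal_mul r.coe_nonneg, ENNReal.ofReal_sub _ z.coe_nonneg]
    simp
  rw [lintegral_countable', tsum_congr hterm,
    ← ENNReal.ofReal_tsum_of_nonneg (fun n => by positivity) hsum.summable, hsum.tsum_eq,
    hexponent, eexpNeg_ofReal (mul_nonneg r.coe_nonneg (sub_nonneg.2 hz'))]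

theorem exists_monotone_tendsto_simpleFunc_finMeasSupp {E : Type*} [MeasurableSpace E]
    (Λ : Measure E) [SigmaFinite Λ] {f : E → ℝ≥0∞} (hf : Measurable f) :
    ∃ g : ℕ → SimpleFunc E ℝ≥0∞, (∀ n, (g n).FinMeasSupp Λ) ∧ (∀ x, Monotone fun n => g n x) ∧
      ∀ x, Tendsto (fun n => g n x) atTop (𝓝 (f x)) := by
  have happly (n : ℕ) (x : E) : (SimpleFunc.eapprox f n).restrict (spanningSets Λ n) x =
      (spanningSets Λ n).indicator (SimpleFunc.eapprox f n) x :=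
    SimpleFunc.restrict_apply _ (measurableSet_spanningSets Λ n) x
  refine ⟨fun n => (SimpleFunc.eapprox f n).restrict (spanningSets Λ n), fun n => ?_,
    fun x m n hmn => ?_, fun x => ?_⟩
  · refine SimpleFunc.finMeasSupp_iff_support.2
      ((measure_mono fun x hx => ?_).trans_lt (measure_spanningSets_lt_top Λ n))
    rw [Function.mem_support, happly] at hx
    exact Set.mem_of_indicator_ne_zero hx
  · simp only [happly]
    exact (Set.indicator_le_indicator (SimpleFunc.monotone_eapprox f hmn x)).trans
      (Set.indicator_le_indicator_of_subset (monotone_spanningSets Λ hmn) (fun _ => zero_le) x)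
  · have hlim : Tendsto (fun n => SimpleFunc.eapprox f n x) atTop (𝓝 (f x)) := by
      rw [← SimpleFunc.iSup_eapprox_apply hf x]
      exact tendsto_atTop_iSup fun m n hmn => SimpleFunc.monotone_eapprox f hmn x
    refine hlim.congr' ?_
    filter_upwards [eventually_ge_atTop (spanningSetsIndex Λ x)] with n hn
    rw [happly, Set.indicator_of_mem]
    exact monotone_spanningSets Λ hn (mem_spanningSetsIndex Λ x)

namespace IsPoissonPointProcess

variable {Ω E : Type*} [MeasurableSpace Ω] [MeasurableSpace E] {μ : Measure Ω}
  {Φ : Ω → Measure E} {Λ : Measure E}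

theorem measurable_lintegral (h : IsPoissonPointProcess μ Φ Λ) {f : E → ℝ≥0∞}
    (hf : Measurable f) : Measurable fun ω => ∫⁻ x, f x ∂Φ ω :=
  (Measure.measurable_lintegral hf).comp
    (Measure.measurable_of_measurable_coe _ h.measurable_count)

theorem iIndepFun_count (h : IsPoissonPointProcess μ Φ Λ) {ι : Type*} [Finite ι]
    {A : ι → Set E} (hA : ∀ i, MeasurableSet (A i))
    (hd : Pairwise fun i j => Disjoint (A i) (A j)) :
    iIndepFun (fun i ω => Φ ω (A i)) μ := by
  let e := Finite.equivFin ι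
  have hFin := h.count_indep (Nat.card ι) (fun k => A (e.symm k)) (fun k => hA _)
    (hd.comp_of_injective e.symm.injective)
  simpa using hFin.precomp e.injective

theorem ae_count_eq_zero (h : IsPoissonPointProcess μ Φ Λ) {A : Set E} (hA : MeasurableSet A)
    (hnull : Λ A = 0) : ∀ᵐ ω ∂μ, Φ ω A = 0 := by
  have hlaw := h.count_law A hA (by simp [hnull])
  refine ae_of_ae_map (p := (· = 0)) (h.measurable_count A hA).aemeasurable ?_
  rw [hlaw, ae_map_iff Measurable.of_discrete.aemeasurable (measurableSet_eq_fun (by fun_prop)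
    (by fun_prop)), ae_iff_of_countable]
  intro k
  rcases eq_or_ne k 0 with rfl | hk <;> simp [*, poissonMeasure_singleton]

theorem lintegral_eexpNeg_mul_count (h : IsPoissonPointProcess μ Φ Λ) {A : Set E}
    (hA : MeasurableSet A) (hfin : Λ A < ∞) (y : ℝ≥0∞) :
    ∫⁻ ω, eexpNeg (y * Φ ω A) ∂μ = eexpNeg ((1 - eexpNeg y) * Λ A) := by
  have hmeas : Measurable fun x : ℝ≥0∞ => eexpNeg (y * x) := by fun_prop
  calc ∫⁻ ω, eexpNeg (y * Φ ω A) ∂μ = ∫⁻ x, eexpNeg (y * x) ∂μ.map (fun ω => Φ ω A) :=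
        (lintegral_map hmeas (h.measurable_count A hA)).symm
    _ = ∫⁻ k, eexpNeg (y * k) ∂poissonMeasure (Λ A).toNNReal := by
        rw [h.count_law A hA hfin, lintegral_map hmeas Measurable.of_discrete]
    _ = ∫⁻ k, eexpNeg y ^ k ∂poissonMeasure (Λ A).toNNReal := by
        simp_rw [mul_comm y, eexpNeg_natCast_mul]
    _ = eexpNeg ((1 - eexpNeg y) * Λ A) := by
        rw [lintegral_pow_poissonMeasure _ (eexpNeg_le_one y), ENNReal.coe_toNNReal hfin.ne,
          mul_comm]

theorem lintegral_eexpNeg_lintegral_simpleFunc (h : IsPoissonPointProcess μ Φ Λ)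
    (f : SimpleFunc E ℝ≥0∞) (hf : f.FinMeasSupp Λ) :
    ∫⁻ ω, eexpNeg (∫⁻ x, f x ∂Φ ω) ∂μ = eexpNeg (∫⁻ x, (1 - eexpNeg (f x)) ∂Λ) := by
  classical
  let S : Finset ℝ≥0∞ := f.range.filter (· ≠ 0)
  have lintegral_comp (ψ : ℝ≥0∞ → ℝ≥0∞) (hψ : ψ 0 = 0) (ν : Measure E) :
      ∫⁻ x, ψ (f x) ∂ν = ∑ y : S, ψ y * ν (f ⁻¹' {y.1}) := by
    calc ∫⁻ x, ψ (f x) ∂ν = ∑ y ∈ f.range, ψ y * ν (f ⁻¹' {y}) :=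
          ((f.map ψ).lintegral_eq_lintegral ν).trans (f.map_lintegral ψ)
      _ = ∑ y ∈ S, ψ y * ν (f ⁻¹' {y}) :=
          (Finset.sum_filter_of_ne (p := (· ≠ 0)) fun y _ hy h0 =>
            hy (by rw [h0, hψ, zero_mul])).symm
      _ = ∑ y : S, ψ y * ν (f ⁻¹' {y.1}) := (Finset.sum_coe_sort S _).symm
  have hindep : iIndepFun (fun (y : S) ω => eexpNeg (y.1 * Φ ω (f ⁻¹' {y.1}))) μ :=
    (h.iIndepFun_count (fun y : S => f.measurableSet_preimage {y.1}) fun y z hyz =>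
      Disjoint.preimage _ (Set.disjoint_singleton.2 (Subtype.coe_ne_coe.2 hyz))).comp
      (fun y x => eexpNeg (y.1 * x)) fun y => by fun_prop
  have hcount (y : S) := h.measurable_count _ (f.measurableSet_preimage {y.1})
  simp_rw [lintegral_comp (fun y => y) rfl, eexpNeg_sum]
  rw [lintegral_comp (fun y => 1 - eexpNeg y) (by simp), eexpNeg_sum,
    lintegral_prod_eq_prod_lintegral_of_indepFun _ _ hindep fun y => by fun_prop]
  refine Finset.prod_congr rfl fun y _ => h.lintegral_eexpNeg_mul_count
    (f.measurableSet_preimage _) ?_ y.1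
  exact SimpleFunc.finMeasSupp_iff.1 hf y (Finset.mem_filter.1 y.2).2

theorem lintegral_eexpNeg_lintegral [IsFiniteMeasure μ] [SigmaFinite Λ]
    (h : IsPoissonPointProcess μ Φ Λ) {f : E → ℝ≥0∞} (hf : Measurable f) :
    ∫⁻ ω, eexpNeg (∫⁻ x, f x ∂Φ ω) ∂μ = eexpNeg (∫⁻ x, (1 - eexpNeg (f x)) ∂Λ) := by
  obtain ⟨g, hgfin, hgmono, hglim⟩ := exists_monotone_tendsto_simpleFunc_finMeasSupp Λ hf
  have hleft : Tendsto (fun n => ∫⁻ ω, eexpNeg (∫⁻ x, g n x ∂Φ ω) ∂μ) atTop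
      (𝓝 (∫⁻ ω, eexpNeg (∫⁻ x, f x ∂Φ ω) ∂μ)) := by
    refine tendsto_lintegral_of_le_one
      (fun n => measurable_eexpNeg.comp (h.measurable_lintegral (g n).measurable))
      (fun n ω => eexpNeg_le_one _) (ae_of_all _ fun ω => (continuous_eexpNeg.tendsto _).comp ?_)
    exact lintegral_tendsto_of_tendsto_of_monotone (fun n => (g n).measurable.aemeasurable)
      (ae_of_all _ hgmono) (ae_of_all _ hglim)
  have hright : Tendsto (fun n => eexpNeg (∫⁻ x, (1 - eexpNeg (g n x)) ∂Λ)) atTop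
      (𝓝 (eexpNeg (∫⁻ x, (1 - eexpNeg (f x)) ∂Λ))) := by
    refine (continuous_eexpNeg.tendsto _).comp (lintegral_tendsto_of_tendsto_of_monotone
      (fun n => ?_) (ae_of_all _ fun x m n hmn => ?_) (ae_of_all _ fun x => ?_))
    · have := (g n).measurable
      fun_prop
    · exact tsub_le_tsub_left (antitone_eexpNeg (hgmono x hmn)) _
    · exact ENNReal.Tendsto.sub tendsto_const_nhds ((continuous_eexpNeg.tendsto _).comp (hglim x))
        (Or.inl ENNReal.one_ne_top)
  simp_rw [h.lintegral_eexpNeg_lintegral_simpleFunc _ (hgfin _)] at hleft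
  exact tendsto_nhds_unique hleft hright

end IsPoissonPointProcess

/-! ### Conditioning a ranked Poisson point process on its nearest point -/

section NormTruncation

variable {E : Type*} [NormedAddCommGroup E] [MeasurableSpace E] [BorelSpace E]

theorem measurableSet_le_norm (t : ℝ) : MeasurableSet {x : E | t ≤ ‖x‖} :=
  measurableSet_le measurable_const measurable_norm

theorem tendsto_setLIntegral_le_norm (Λ : Measure E) {g : E → ℝ≥0∞} (hg : Measurable g)
    {u : ℕ → ℝ} {r : ℝ} (hu : ∀ m, r < u m) (hlim : Tendsto u atTop (𝓝 r)) :
    Tendsto (fun m => ∫⁻ x in {x | u m ≤ ‖x‖}, g x ∂Λ) atTop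
      (𝓝 (∫⁻ x in {x | r < ‖x‖}, g x ∂Λ)) := by
  refine tendsto_of_le_liminf_of_limsup_le ?_ (limsup_le_of_le (h := Eventually.of_forall fun m =>
    lintegral_mono_set fun x hx => (hu m).trans_le hx))
  simp_rw [← lintegral_indicator (measurableSet_le_norm _),
    ← lintegral_indicator (measurableSet_lt measurable_const measurable_norm)]
  refine le_trans (lintegral_mono fun x => ?_)
    (lintegral_liminf_le fun m => hg.indicator (measurableSet_le_norm _))
  by_cases hx : r < ‖x‖
  · have hconst : Tendsto (fun m => {x | u m ≤ ‖x‖}.indicator g x) atTop (𝓝 (g x)) := by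
      refine tendsto_const_nhds.congr' ?_
      filter_upwards [hlim.eventually_lt_const hx] with m hm
      simp [hm.le]
    exact (Set.indicator_le_self _ _ _).trans_eq hconst.liminf_eq.symm
  · simp [hx]

end NormTruncation

theorem eventually_tsum_indicator_le_norm_eq {E : Type*} [NormedAddCommGroup E]
    (f : E → ℝ≥0∞) {w : ℕ → E} (hw : StrictMono fun n => ‖w n‖) {u : ℕ → ℝ}
    (hu : ∀ m, ‖w 0‖ < u m) (hlim : Tendsto u atTop (𝓝 ‖w 0‖)) :
    ∀ᶠ m in atTop, ∑' n, {x | u m ≤ ‖x‖}.indicator f (w n) = ∑' n, f (w (n + 1)) := by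
  filter_upwards [hlim.eventually_lt_const (hw Nat.zero_lt_one)] with m hm
  have hin (n : ℕ) : u m ≤ ‖w (n + 1)‖ := hm.le.trans (hw.monotone (Nat.le_add_left 1 n))
  rw [tsum_eq_zero_add' (f := fun n => Set.indicator _ f (w n)) ENNReal.summable]
  simp [hin, hu m]

theorem lt_floor_mul_add_one_div (r : ℝ) (m : ℕ) :
    r < ((⌊r * (m + 1)⌋₊ + 1) / (m + 1) : ℝ) :=
  (lt_div_iff₀ (by positivity)).2 (Nat.lt_floor_add_one _)

theorem tendsto_floor_mul_add_one_div {r : ℝ} (hr : 0 ≤ r) :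
    Tendsto (fun m : ℕ => ((⌊r * (m + 1)⌋₊ + 1) / (m + 1) : ℝ)) atTop (𝓝 r) := by
  refine tendsto_of_tendsto_of_tendsto_of_le_of_le tendsto_const_nhds
    (by simpa only [add_zero] using tendsto_one_div_add_atTop_nhds_zero_nat.const_add r)
    (fun m => (lt_floor_mul_add_one_div r m).le) fun m => ?_
  have hm : (0 : ℝ) < m + 1 := by positivity
  rw [div_le_iff₀ hm, add_mul, one_div_mul_cancel hm.ne']
  gcongr
  exact Nat.floor_le (by positivity)

namespace IsPoissonPointProcess

variable {Ω E : Type*} [MeasurableSpace Ω] [NormedAddCommGroup E] [MeasurableSpace E]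
  [BorelSpace E] {μ : Measure Ω} [IsFiniteMeasure μ] {v : ℕ → Ω → E} {Λ : Measure E} [SigmaFinite Λ]
  {f : E → ℝ≥0∞}

theorem setLIntegral_le_nearest (hv : ∀ n, Measurable (v n))
    (hranked : ∀ᵐ ω ∂μ, StrictMono fun n => ‖v n ω‖)
    (h : IsPoissonPointProcess μ (fun ω => Measure.sum fun n => Measure.dirac (v n ω)) Λ)
    (hf : Measurable f) {a t : ℝ} (hat : a ≤ t) :
    ∫⁻ ω in {ω | a ≤ ‖v 0 ω‖}, eexpNeg (∑' n, {x | t ≤ ‖x‖}.indicator f (v n ω)) ∂μ =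
      eexpNeg (Λ {x | ‖x‖ < a}) * eexpNeg (∫⁻ x in {x | t ≤ ‖x‖}, (1 - eexpNeg (f x)) ∂Λ) := by
  have hball : MeasurableSet {x : E | ‖x‖ < a} := measurableSet_lt measurable_norm measurable_const
  -- an infinite weight on the ball restricts the expectation to the event that it is empty
  let F : E → ℝ≥0∞ := {x | ‖x‖ < a}.indicator (fun _ => ∞) + {x | t ≤ ‖x‖}.indicator f
  have hF : Measurable F :=
    (measurable_const.indicator hball).add (hf.indicator (measurableSet_le_norm t))
  have hintensity : ∫⁻ x, (1 - eexpNeg (F x)) ∂Λ =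
      Λ {x | ‖x‖ < a} + ∫⁻ x in {x | t ≤ ‖x‖}, (1 - eexpNeg (f x)) ∂Λ := by
    rw [← lintegral_indicator_one hball, ← lintegral_indicator (measurableSet_le_norm t),
      ← lintegral_add_left (measurable_one.indicator hball)]
    refine lintegral_congr fun x => ?_
    by_cases hxa : ‖x‖ < a
    · simp [F, hxa, hxa.trans_le hat]
    · by_cases hxt : t ≤ ‖x‖ <;> simp [F, hxa, hxt]
  rw [← eexpNeg_add, ← hintensity, ← h.lintegral_eexpNeg_lintegral hF,
    ← lintegral_indicator (measurableSet_le measurable_const (hv 0).norm)]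
  refine lintegral_congr_ae (hranked.mono fun ω hω => ?_)
  simp only [lintegral_sum_measure, lintegral_dirac' _ hF]
  by_cases h0 : a ≤ ‖v 0 ω‖
  · rw [Set.indicator_of_mem (by exact h0)]
    have hout (n : ℕ) : ¬ ‖v n ω‖ < a := not_lt.2 (h0.trans (hω.monotone (Nat.zero_le n)))
    simp [F, hout]
  · rw [Set.indicator_of_notMem (by exact h0), ENNReal.tsum_eq_top_of_eq_top, eexpNeg_top]
    exact ⟨0, by simp [F, not_le.1 h0]⟩

theorem setLIntegral_nearest_of_subset_Iio (hv : ∀ n, Measurable (v n))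
    (hranked : ∀ᵐ ω ∂μ, StrictMono fun n => ‖v n ω‖)
    (h : IsPoissonPointProcess μ (fun ω => Measure.sum fun n => Measure.dirac (v n ω)) Λ)
    (hf : Measurable f) {t : ℝ} {A : Set ℝ} (hA : MeasurableSet A) (hAt : A ⊆ Set.Iio t) :
    ∫⁻ ω in {ω | ‖v 0 ω‖ ∈ A}, eexpNeg (∑' n, {x | t ≤ ‖x‖}.indicator f (v n ω)) ∂μ =
      ∫⁻ _ω in {ω | ‖v 0 ω‖ ∈ A},
        eexpNeg (∫⁻ x in {x | t ≤ ‖x‖}, (1 - eexpNeg (f x)) ∂Λ) ∂μ := by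
  set H := ∫⁻ x in {x | t ≤ ‖x‖}, (1 - eexpNeg (f x)) ∂Λ
  have hmin : Measurable fun ω => min ‖v 0 ω‖ t := (hv 0).norm.min measurable_const
  let lawOf (Y : Ω → ℝ≥0∞) : Measure ℝ := (μ.withDensity Y).map fun ω => min ‖v 0 ω‖ t
  have hlawOf (Y : Ω → ℝ≥0∞) {B : Set ℝ} (hB : MeasurableSet B) :
      lawOf Y B = ∫⁻ ω in {ω | min ‖v 0 ω‖ t ∈ B}, Y ω ∂μ := by
    rw [Measure.map_apply hmin hB, withDensity_apply _ (hmin hB)]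
    rfl
  have hempty (a : ℝ) (hat : a ≤ t) : μ {ω | a ≤ ‖v 0 ω‖} = eexpNeg (Λ {x | ‖x‖ < a}) := by
    simpa using h.setLIntegral_le_nearest hv hranked (f := 0) measurable_const hat
  have hlaw : lawOf (fun ω => eexpNeg (∑' n, {x | t ≤ ‖x‖}.indicator f (v n ω))) =
      lawOf fun _ => eexpNeg H := by
    have := isFiniteMeasure_withDensity (μ := μ)
      (f := fun ω => eexpNeg (∑' n, {x | t ≤ ‖x‖}.indicator f (v n ω)))
      (ne_top_of_le_ne_top (measure_ne_top μ Set.univ)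
        ((lintegral_mono fun ω => eexpNeg_le_one _).trans_eq (by simp)))
    refine Measure.ext_of_Ici _ _ fun a => ?_
    rw [hlawOf _ measurableSet_Ici, hlawOf _ measurableSet_Ici]
    rcases le_or_gt a t with hat | hta
    · simp only [Set.mem_Ici, le_min_iff, hat, and_true]
      rw [h.setLIntegral_le_nearest hv hranked hf hat, setLIntegral_const, hempty a hat, mul_comm]
    · simp [hta.not_ge]
  have hset : {ω | min ‖v 0 ω‖ t ∈ A} = {ω | ‖v 0 ω‖ ∈ A} := by
    ext ω
    rcases le_total ‖v 0 ω‖ t with hle | hge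
    · simp [hle]
    · have htA : t ∉ A := fun ht => lt_irrefl t (hAt ht)
      have hvA : ‖v 0 ω‖ ∉ A := fun hmem => (hAt hmem).not_ge hge
      simp [hge, htA, hvA]
  have hlawA := congrArg (· A) hlaw
  simpa only [hlawOf _ hA, hset] using hlawA

theorem setLIntegral_nearest_discretization (hv : ∀ n, Measurable (v n))
    (hranked : ∀ᵐ ω ∂μ, StrictMono fun n => ‖v n ω‖)
    (h : IsPoissonPointProcess μ (fun ω => Measure.sum fun n => Measure.dirac (v n ω)) Λ)
    (hf : Measurable f) {A : Set ℝ} (hA : MeasurableSet A) {k : ℝ → ℕ} (hk : Measurable k)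
    {c : ℕ → ℝ} (hc : ∀ r, r < c (k r)) :
    ∫⁻ ω in {ω | ‖v 0 ω‖ ∈ A},
        eexpNeg (∑' n, {x | c (k ‖v 0 ω‖) ≤ ‖x‖}.indicator f (v n ω)) ∂μ =
      ∫⁻ ω in {ω | ‖v 0 ω‖ ∈ A},
        eexpNeg (∫⁻ x in {x | c (k ‖v 0 ω‖) ≤ ‖x‖}, (1 - eexpNeg (f x)) ∂Λ) ∂μ := by
  let cell (j : ℕ) : Set ℝ := A ∩ k ⁻¹' {j}
  have hcell (j : ℕ) : MeasurableSet (cell j) := hA.inter (hk (measurableSet_singleton j))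
  have hcellΩ (j : ℕ) : MeasurableSet {ω | ‖v 0 ω‖ ∈ cell j} := (hv 0).norm (hcell j)
  have hunion : {ω | ‖v 0 ω‖ ∈ A} = ⋃ j, {ω | ‖v 0 ω‖ ∈ cell j} := by
    ext ω
    simp [cell]
  have hdisj : Pairwise (Function.onFun Disjoint fun j => {ω | ‖v 0 ω‖ ∈ cell j}) :=
    fun i j hij => Set.disjoint_left.2 fun ω hi hj => hij (hi.2.symm.trans hj.2)
  rw [hunion, lintegral_iUnion hcellΩ hdisj, lintegral_iUnion hcellΩ hdisj]
  refine tsum_congr fun j => ?_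
  have hkj {ω : Ω} (hω : ω ∈ {ω | ‖v 0 ω‖ ∈ cell j}) : k ‖v 0 ω‖ = j := hω.2
  calc _ = ∫⁻ ω in {ω | ‖v 0 ω‖ ∈ cell j},
        eexpNeg (∑' n, {x | c j ≤ ‖x‖}.indicator f (v n ω)) ∂μ :=
        setLIntegral_congr_fun (hcellΩ j) fun ω hω => by simp only [hkj hω]
    _ = ∫⁻ _ω in {ω | ‖v 0 ω‖ ∈ cell j},
        eexpNeg (∫⁻ x in {x | c j ≤ ‖x‖}, (1 - eexpNeg (f x)) ∂Λ) ∂μ :=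
        h.setLIntegral_nearest_of_subset_Iio hv hranked hf (hcell j) fun r hr => hr.2 ▸ hc r
    _ = _ := setLIntegral_congr_fun (hcellΩ j) fun ω hω => by simp only [hkj hω]

theorem setLIntegral_nearest (hv : ∀ n, Measurable (v n))
    (hranked : ∀ᵐ ω ∂μ, StrictMono fun n => ‖v n ω‖)
    (h : IsPoissonPointProcess μ (fun ω => Measure.sum fun n => Measure.dirac (v n ω)) Λ)
    (hf : Measurable f) {A : Set ℝ} (hA : MeasurableSet A) :
    ∫⁻ ω in {ω | ‖v 0 ω‖ ∈ A}, eexpNeg (∑' n, f (v (n + 1) ω)) ∂μ =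
      ∫⁻ ω in {ω | ‖v 0 ω‖ ∈ A},
        eexpNeg (∫⁻ x in {x | ‖v 0 ω‖ < ‖x‖}, (1 - eexpNeg (f x)) ∂Λ) ∂μ := by
  let u (m : ℕ) (r : ℝ) : ℝ := (⌊r * (m + 1)⌋₊ + 1) / (m + 1)
  have hfloor (m : ℕ) : Measurable fun r : ℝ => ⌊r * (m + 1)⌋₊ :=
    Nat.measurable_floor.comp (measurable_id.mul_const _)
  have hu (m : ℕ) : Measurable (u m) :=
    (((measurable_from_nat (f := Nat.cast)).comp (hfloor m)).add_const 1).div_const _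
  have hlt (m : ℕ) (r : ℝ) : r < u m r := lt_floor_mul_add_one_div r m
  have hulim (ω : Ω) : Tendsto (fun m => u m ‖v 0 ω‖) atTop (𝓝 ‖v 0 ω‖) :=
    tendsto_floor_mul_add_one_div (norm_nonneg _)
  have hpoints : Tendsto (fun m => ∫⁻ ω in {ω | ‖v 0 ω‖ ∈ A},
      eexpNeg (∑' n, {x | u m ‖v 0 ω‖ ≤ ‖x‖}.indicator f (v n ω)) ∂μ) atTop
      (𝓝 (∫⁻ ω in {ω | ‖v 0 ω‖ ∈ A}, eexpNeg (∑' n, f (v (n + 1) ω)) ∂μ)) := by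
    refine tendsto_lintegral_of_le_one (fun m => measurable_eexpNeg.comp
      (Measurable.tsum fun n => ?_)) (fun m ω => eexpNeg_le_one _) ?_
    · exact (hf.comp (hv n)).indicator
        (measurableSet_le ((hu m).comp (hv 0).norm) (hv n).norm)
    · filter_upwards [ae_restrict_of_ae hranked] with ω hω
      exact tendsto_const_nhds.congr' ((eventually_tsum_indicator_le_norm_eq f hω
        (fun m => hlt m _) (hulim ω)).mono fun m hm => congrArg eexpNeg hm.symm)
  have hintensity : Tendsto (fun m => ∫⁻ ω in {ω | ‖v 0 ω‖ ∈ A},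
      eexpNeg (∫⁻ x in {x | u m ‖v 0 ω‖ ≤ ‖x‖}, (1 - eexpNeg (f x)) ∂Λ) ∂μ) atTop
      (𝓝 (∫⁻ ω in {ω | ‖v 0 ω‖ ∈ A},
        eexpNeg (∫⁻ x in {x | ‖v 0 ω‖ < ‖x‖}, (1 - eexpNeg (f x)) ∂Λ) ∂μ)) := by
    have hanti : Antitone fun t : ℝ => ∫⁻ x in {x | t ≤ ‖x‖}, (1 - eexpNeg (f x)) ∂Λ :=
      fun _ _ hst => lintegral_mono_set fun _ hx => hst.trans hx
    exact tendsto_lintegral_of_le_one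
      (fun m => measurable_eexpNeg.comp (hanti.measurable.comp ((hu m).comp (hv 0).norm)))
      (fun m ω => eexpNeg_le_one _) (ae_of_all _ fun ω => (continuous_eexpNeg.tendsto _).comp
        (tendsto_setLIntegral_le_norm Λ (by fun_prop) (fun m => hlt m _) (hulim ω)))
  have heq (m : ℕ) := h.setLIntegral_nearest_discretization hv hranked hf hA (hfloor m)
    (c := fun j => (j + 1) / (m + 1)) (hlt m)
  exact tendsto_nhds_unique hpoints (hintensity.congr fun m => (heq m).symm)

end IsPoissonPointProcess

/-! ### Conditionally independent marks -/

theorem lintegral_comp_prodMk_of_rectangle {Ω α M : Type*} [MeasurableSpace Ω]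
    [MeasurableSpace α] [MeasurableSpace M] {m m' : Measure Ω} [IsFiniteMeasure m]
    {Γ : Measure M} [IsProbabilityMeasure Γ] {X : Ω → α} {Z : Ω → M} (hX : Measurable X)
    (hZ : Measurable Z)
    (hrect : ∀ B T, MeasurableSet B → MeasurableSet T →
      m {ω | X ω ∈ B ∧ Z ω ∈ T} = m' {ω | X ω ∈ B} * Γ T)
    {F : α → M → ℝ≥0∞} (hF : Measurable (Function.uncurry F)) :
    ∫⁻ ω, F (X ω) (Z ω) ∂m = ∫⁻ ω, ∫⁻ z, F (X ω) z ∂Γ ∂m' := by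
  have : IsFiniteMeasure m' :=
    ⟨by simpa using (hrect Set.univ Set.univ .univ .univ).symm.trans_lt (by simp)⟩
  have hlaw : (m'.map X).prod Γ = m.map fun ω => (X ω, Z ω) := by
    refine Measure.prod_eq fun B T hB hT => ?_
    rw [Measure.map_apply (hX.prodMk hZ) (hB.prod hT), Measure.map_apply hX hB]
    exact hrect B T hB hT
  calc ∫⁻ ω, F (X ω) (Z ω) ∂m = ∫⁻ p, Function.uncurry F p ∂m.map fun ω => (X ω, Z ω) :=
        (lintegral_map hF (hX.prodMk hZ)).symm
    _ = ∫⁻ x, ∫⁻ z, F x z ∂Γ ∂m'.map X := by rw [← hlaw, lintegral_prod _ hF.aemeasurable]; rfl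
    _ = ∫⁻ ω, ∫⁻ z, F (X ω) z ∂Γ ∂m' := lintegral_map hF.lintegral_prod_right' hX

section UpdateInsert

variable {ι κ β : Type*} [DecidableEq ι] {S : Finset ι} {a : ι}

theorem forall_mem_insert_update_iff (ha : a ∉ S) (c : ι → κ) (T : ι → β) (d : κ) (t : β)
    (p : ι → κ → β → Prop) :
    (∀ n ∈ insert a S, p n (Function.update c a d n) (Function.update T a t n)) ↔
      p a d t ∧ ∀ n ∈ S, p n (c n) (T n) := by
  rw [Finset.forall_mem_insert, Function.update_self, Function.update_self]
  refine and_congr_right' (forall₂_congr fun n hn => ?_)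
  have hna : n ≠ a := ne_of_mem_of_not_mem hn ha
  rw [Function.update_of_ne hna, Function.update_of_ne hna]

theorem prod_insert_update {M : Type*} [CommMonoid M] (ha : a ∉ S) (c : ι → κ) (T : ι → β) (d : κ)
    (t : β) (F : ι → κ → β → M) :
    ∏ n ∈ insert a S, F n (Function.update c a d n) (Function.update T a t n) =
      F a d t * ∏ n ∈ S, F n (c n) (T n) := by
  rw [Finset.prod_insert ha, Function.update_self, Function.update_self]
  refine congrArg _ (Finset.prod_congr rfl fun n hn => ?_)
  have hna : n ≠ a := ne_of_mem_of_not_mem hn ha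
  rw [Function.update_of_ne hna, Function.update_of_ne hna]

end UpdateInsert

/-- Marks `(C n, Z n)` that are independent given `X`: the state `C n` equals `c` with conditional
probability `w n c X`, and given this state the value `Z n` has law `Γ c`. The conditional law is
encoded by the probabilities of the events `X ∈ B`, `C n = c n`, `Z n ∈ T n`. -/
structure IsConditionallyIndepMarking {Ω α κ M ι : Type*} [MeasurableSpace Ω] [MeasurableSpace α]
    [MeasurableSpace κ] [MeasurableSpace M] (μ : Measure Ω) (X : Ω → α) (C : ι → Ω → κ)
    (Z : ι → Ω → M) (w : ι → κ → α → ℝ≥0∞) (Γ : κ → Measure M) : Prop where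
  measurable_base : Measurable X
  measurable_state : ∀ n, Measurable (C n)
  measurable_value : ∀ n, Measurable (Z n)
  measurable_weight : ∀ n c, Measurable (w n c)
  measure_rectangle : ∀ (B : Set α) (S : Finset ι) (c : ι → κ) (T : ι → Set M),
    MeasurableSet B → (∀ n, MeasurableSet (T n)) →
    μ {ω | X ω ∈ B ∧ ∀ n ∈ S, C n ω = c n ∧ Z n ω ∈ T n} =
      ∫⁻ ω in {ω | X ω ∈ B}, ∏ n ∈ S, w n (c n) (X ω) * Γ (c n) (T n) ∂μ

/-- `R X` is the conditional expectation of `P` given `X`, and `P` is conditionally independent of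
the marks with index in `S`; the law of these marks is that of `IsConditionallyIndepMarking`. -/
def HasRectangleIntegral {Ω α κ M ι : Type*} [MeasurableSpace Ω] [MeasurableSpace α]
    [MeasurableSpace M] (μ : Measure Ω) (X : Ω → α) (C : ι → Ω → κ) (Z : ι → Ω → M)
    (w : ι → κ → α → ℝ≥0∞) (Γ : κ → Measure M) (S : Finset ι) (P : Ω → ℝ≥0∞) (R : α → ℝ≥0∞) :
    Prop :=
  ∀ (B : Set α) (c : ι → κ) (T : ι → Set M), MeasurableSet B → (∀ n, MeasurableSet (T n)) →
    ∫⁻ ω in {ω | X ω ∈ B ∧ ∀ n ∈ S, C n ω = c n ∧ Z n ω ∈ T n}, P ω ∂μ =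
      ∫⁻ ω in {ω | X ω ∈ B}, (∏ n ∈ S, w n (c n) (X ω) * Γ (c n) (T n)) * R (X ω) ∂μ

section Marking

variable {Ω α κ M ι : Type*} [MeasurableSpace Ω] [MeasurableSpace α] [MeasurableSpace M]
  {μ : Measure Ω} {X : Ω → α} {C : ι → Ω → κ} {Z : ι → Ω → M}
  {w : ι → κ → α → ℝ≥0∞} {Γ : κ → Measure M}

theorem HasRectangleIntegral.setLIntegral_insert [DecidableEq ι] {a : ι} {S : Finset ι}
    {P : Ω → ℝ≥0∞} {R : α → ℝ≥0∞} (hPR : HasRectangleIntegral μ X C Z w Γ (insert a S) P R)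
    (ha : a ∉ S) {B : Set α} (hB : MeasurableSet B) (c : ι → κ) {T : ι → Set M}
    (hT : ∀ n, MeasurableSet (T n)) (d : κ) {T' : Set M} (hT' : MeasurableSet T') :
    ∫⁻ ω in {ω | X ω ∈ B ∧ (C a ω = d ∧ Z a ω ∈ T') ∧ ∀ n ∈ S, C n ω = c n ∧ Z n ω ∈ T n},
        P ω ∂μ =
      ∫⁻ ω in {ω | X ω ∈ B}, w a d (X ω) * Γ d T' *
        (∏ n ∈ S, w n (c n) (X ω) * Γ (c n) (T n)) * R (X ω) ∂μ := by
  have hiff (ω : Ω) :=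
    forall_mem_insert_update_iff ha c T d T' fun n c T => C n ω = c ∧ Z n ω ∈ T
  have hprod (x : α) := prod_insert_update ha c T d T' fun n c T => w n c x * Γ c T
  have hinsert := hPR B (Function.update c a d) (Function.update T a T') hB fun n => by
    rcases eq_or_ne n a with rfl | hn <;> simp [*]
  simpa only [hiff, hprod] using hinsert

variable [MeasurableSpace κ]

theorem HasRectangleIntegral.setLIntegral_inter_state [IsFiniteMeasure μ]
    [∀ c, IsProbabilityMeasure (Γ c)] [DecidableEq ι] {a : ι} {S : Finset ι} {P : Ω → ℝ≥0∞}
    {R : α → ℝ≥0∞} {g : κ → α → M → ℝ≥0∞}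
    (hPR : HasRectangleIntegral μ X C Z w Γ (insert a S) P R)
    (h : IsConditionallyIndepMarking μ X C Z w Γ) (ha : a ∉ S) (hP : Measurable P)
    (hP1 : ∀ ω, P ω ≤ 1) (hR : Measurable R) (hg : ∀ c, Measurable (Function.uncurry (g c)))
    {B : Set α} (hB : MeasurableSet B) (c : ι → κ) {T : ι → Set M}
    (hT : ∀ n, MeasurableSet (T n)) (d : κ) :
    ∫⁻ ω in {ω | X ω ∈ B ∧ ∀ n ∈ S, C n ω = c n ∧ Z n ω ∈ T n} ∩ C a ⁻¹' {d},
        P ω * g d (X ω) (Z a ω) ∂μ =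
      ∫⁻ ω in {ω | X ω ∈ B}, (∏ n ∈ S, w n (c n) (X ω) * Γ (c n) (T n)) *
        (w a d (X ω) * ∫⁻ z, g d (X ω) z ∂Γ d) * R (X ω) ∂μ := by
  set D := {ω | X ω ∈ B ∧ ∀ n ∈ S, C n ω = c n ∧ Z n ω ∈ T n} ∩ C a ⁻¹' {d}
  let Q (x : α) : ℝ≥0∞ := (∏ n ∈ S, w n (c n) x * Γ (c n) (T n)) * w a d x * R x
  have hX := h.measurable_base
  have hw := h.measurable_weight
  have hQ : Measurable fun ω => Q (X ω) := by fun_prop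
  have : IsFiniteMeasure ((μ.restrict D).withDensity P) := isFiniteMeasure_withDensity
    (ne_top_of_le_ne_top (measure_ne_top (μ.restrict D) Set.univ)
      ((lintegral_mono hP1).trans_eq (by simp)))
  have hrect (B' : Set α) (T' : Set M) (hB' : MeasurableSet B') (hT' : MeasurableSet T') :
      (μ.restrict D).withDensity P {ω | X ω ∈ B' ∧ Z a ω ∈ T'} =
        (μ.restrict {ω | X ω ∈ B}).withDensity (fun ω => Q (X ω)) {ω | X ω ∈ B'} * Γ d T' := by
    have hset : {ω | X ω ∈ B' ∧ Z a ω ∈ T'} ∩ D = {ω | X ω ∈ B' ∩ B ∧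
        (C a ω = d ∧ Z a ω ∈ T') ∧ ∀ n ∈ S, C n ω = c n ∧ Z n ω ∈ T n} := by
      ext ω
      simp only [D, Set.mem_inter_iff, Set.mem_ofPred_eq, Set.mem_preimage, Set.mem_singleton_iff]
      tauto
    have hBΩ' : MeasurableSet {ω | X ω ∈ B'} := hX hB'
    have hrectΩ : MeasurableSet {ω | X ω ∈ B' ∧ Z a ω ∈ T'} :=
      hBΩ'.inter (h.measurable_value a hT')
    rw [withDensity_apply _ hrectΩ, withDensity_apply _ hBΩ', Measure.restrict_restrict hrectΩ,
      Measure.restrict_restrict hBΩ', hset, hPR.setLIntegral_insert ha (hB'.inter hB) c hT d hT',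
      ← lintegral_mul_const _ hQ]
    exact lintegral_congr fun ω => by simp only [Q]; ring
  have hint := lintegral_comp_prodMk_of_rectangle hX (h.measurable_value a) hrect (hg d)
  have hgX : Measurable fun ω => ∫⁻ z, g d (X ω) z ∂Γ d := (hg d).lintegral_prod_right'.comp hX
  have hgXZ : Measurable fun ω => g d (X ω) (Z a ω) :=
    (hg d).comp (hX.prodMk (h.measurable_value a))
  rw [lintegral_withDensity_eq_lintegral_mul _ hP hgXZ,
    lintegral_withDensity_eq_lintegral_mul _ hQ hgX] at hint
  refine hint.trans (lintegral_congr fun ω => ?_)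
  simp only [Pi.mul_apply, Q]
  ring

variable [MeasurableSingletonClass κ]

theorem IsConditionallyIndepMarking.measurableSet_rectangle
    (h : IsConditionallyIndepMarking μ X C Z w Γ) {B : Set α}
    (hB : MeasurableSet B) (S : Finset ι) (c : ι → κ) {T : ι → Set M}
    (hT : ∀ n, MeasurableSet (T n)) :
    MeasurableSet {ω | X ω ∈ B ∧ ∀ n ∈ S, C n ω = c n ∧ Z n ω ∈ T n} := by
  have hmark (n : ι) : MeasurableSet {ω | C n ω = c n ∧ Z n ω ∈ T n} :=
    (h.measurable_state n (measurableSet_singleton (c n))).inter (h.measurable_value n (hT n))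
  convert (h.measurable_base hB).inter (S.measurableSet_biInter fun n _ => hmark n) using 1
  ext ω
  simp

theorem IsConditionallyIndepMarking.measurable_apply [Finite κ]
    (h : IsConditionallyIndepMarking μ X C Z w Γ)
    {g : κ → α → M → ℝ≥0∞} (hg : ∀ c, Measurable (Function.uncurry (g c))) (n : ι) :
    Measurable fun ω => g (C n ω) (X ω) (Z n ω) := by
  classical
  have := Fintype.ofFinite κ
  have hsum (ω : Ω) : g (C n ω) (X ω) (Z n ω) =
      ∑ c, (C n ⁻¹' {c}).indicator (fun ω => g c (X ω) (Z n ω)) ω := by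
    simp [Set.indicator_apply]
  simp_rw [hsum]
  exact Finset.measurable_sum _ fun c _ =>
    ((hg c).comp (h.measurable_base.prodMk (h.measurable_value n))).indicator
      (h.measurable_state n (measurableSet_singleton c))

theorem HasRectangleIntegral.mul_apply [IsFiniteMeasure μ] [∀ c, IsProbabilityMeasure (Γ c)]
    [Fintype κ] [DecidableEq ι] {a : ι} {S : Finset ι} {P : Ω → ℝ≥0∞} {R : α → ℝ≥0∞}
    {g : κ → α → M → ℝ≥0∞} (hPR : HasRectangleIntegral μ X C Z w Γ (insert a S) P R)
    (h : IsConditionallyIndepMarking μ X C Z w Γ) (ha : a ∉ S) (hP : Measurable P)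
    (hP1 : ∀ ω, P ω ≤ 1) (hR : Measurable R) (hg : ∀ c, Measurable (Function.uncurry (g c))) :
    HasRectangleIntegral μ X C Z w Γ S (fun ω => P ω * g (C a ω) (X ω) (Z a ω))
      (fun x => (∑ d, w a d x * ∫⁻ z, g d x z ∂Γ d) * R x) := by
  intro B c T hB hT
  have hX := h.measurable_base
  have hw := h.measurable_weight
  have hstate (d : κ) : MeasurableSet (C a ⁻¹' {d}) :=
    h.measurable_state a (measurableSet_singleton d)
  set D := {ω | X ω ∈ B ∧ ∀ n ∈ S, C n ω = c n ∧ Z n ω ∈ T n}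
  have hD : MeasurableSet D := h.measurableSet_rectangle hB S c hT
  have hunion : D = ⋃ d, D ∩ C a ⁻¹' {d} := by
    ext ω
    simp
  have hdisj : Pairwise (Function.onFun Disjoint fun d => D ∩ C a ⁻¹' {d}) :=
    fun i j hij => Set.disjoint_left.2 fun ω hi hj => hij (hi.2.symm.trans hj.2)
  calc ∫⁻ ω in D, P ω * g (C a ω) (X ω) (Z a ω) ∂μ
      = ∑ d, ∫⁻ ω in D ∩ C a ⁻¹' {d}, P ω * g (C a ω) (X ω) (Z a ω) ∂μ := by
        conv_lhs => rw [hunion, lintegral_iUnion (fun d => hD.inter (hstate d)) hdisj, tsum_fintype]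
    _ = ∑ d, ∫⁻ ω in D ∩ C a ⁻¹' {d}, P ω * g d (X ω) (Z a ω) ∂μ :=
        Finset.sum_congr rfl fun d _ => setLIntegral_congr_fun (hD.inter (hstate d)) fun ω hω => by
          simp only [show C a ω = d from hω.2]
    _ = _ := by
        simp only [D, hPR.setLIntegral_inter_state h ha hP hP1 hR hg hB c hT]
        rw [← lintegral_finsetSum _ fun d _ => by fun_prop]
        simp only [Finset.mul_sum, Finset.sum_mul, mul_assoc]

namespace IsConditionallyIndepMarking

variable [IsFiniteMeasure μ] [∀ c, IsProbabilityMeasure (Γ c)] [Fintype κ]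
  {f : ι → κ → α → M → ℝ≥0∞}

theorem hasRectangleIntegral_prod (h : IsConditionallyIndepMarking μ X C Z w Γ)
    (hf : ∀ n c, Measurable (Function.uncurry (f n c))) (hf1 : ∀ n c x z, f n c x z ≤ 1)
    {S S' : Finset ι} (hd : Disjoint S S') :
    HasRectangleIntegral μ X C Z w Γ S' (fun ω => ∏ n ∈ S, f n (C n ω) (X ω) (Z n ω))
      (fun x => ∏ n ∈ S, ∑ d, w n d x * ∫⁻ z, f n d x z ∂Γ d) := by
  classical
  induction S using Finset.induction_on generalizing S' with
  | empty =>
    intro B c T hB hT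
    simp [h.measure_rectangle B S' c T hB hT]
  | insert a S haS ih =>
    rw [Finset.disjoint_insert_left] at hd
    have hw := h.measurable_weight
    simp only [Finset.prod_insert haS]
    simp only [mul_comm (f a _ _ _)]
    refine (ih (Finset.disjoint_insert_right.2 ⟨haS, hd.2⟩)).mul_apply h hd.1
      (Finset.measurable_prod _ fun n _ => h.measurable_apply (hf n) n)
      (fun ω => Finset.prod_le_one' fun n _ => hf1 n _ _ _)
      (Finset.measurable_prod _ fun n _ => Finset.measurable_sum _ fun d _ =>
        (hw n d).mul (hf n d).lintegral_prod_right') (hf a)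

theorem setLIntegral_prod (h : IsConditionallyIndepMarking μ X C Z w Γ)
    (hf : ∀ n c, Measurable (Function.uncurry (f n c))) (hf1 : ∀ n c x z, f n c x z ≤ 1)
    (S : Finset ι) {B : Set α} (hB : MeasurableSet B) :
    ∫⁻ ω in {ω | X ω ∈ B}, ∏ n ∈ S, f n (C n ω) (X ω) (Z n ω) ∂μ =
      ∫⁻ ω in {ω | X ω ∈ B}, ∏ n ∈ S, ∑ c, w n c (X ω) * ∫⁻ z, f n c (X ω) z ∂Γ c ∂μ := by
  rcases isEmpty_or_nonempty Ω with _ | ⟨⟨ω₀⟩⟩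
  · simp [Measure.eq_zero_of_isEmpty μ]
  · simpa using h.hasRectangleIntegral_prod hf hf1 (Finset.disjoint_empty_right S) B
      (fun n => C n ω₀) (fun _ => Set.univ) hB fun _ => .univ

theorem setLIntegral_eexpNeg_tsum {C : ℕ → Ω → κ} {Z : ℕ → Ω → M} {w : ℕ → κ → α → ℝ≥0∞}
    (h : IsConditionallyIndepMarking μ X C Z w Γ) (hw : ∀ n x, ∑ c, w n c x ≤ 1)
    {f : ℕ → κ → α → M → ℝ≥0∞} (hf : ∀ n c, Measurable (Function.uncurry (f n c))) {B : Set α}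
    (hB : MeasurableSet B) :
    ∫⁻ ω in {ω | X ω ∈ B}, eexpNeg (∑' n, f n (C n ω) (X ω) (Z n ω)) ∂μ =
      ∫⁻ ω in {ω | X ω ∈ B}, eexpNeg (∑' n, enegLog
        (∑ c, w n c (X ω) * ∫⁻ z, eexpNeg (f n c (X ω) z) ∂Γ c)) ∂μ := by
  have hX := h.measurable_base
  have hexp (n : ℕ) (c : κ) : Measurable (Function.uncurry fun x z => eexpNeg (f n c x z)) :=
    measurable_eexpNeg.comp (hf n c)
  let m (n : ℕ) (x : α) : ℝ≥0∞ := ∑ c, w n c x * ∫⁻ z, eexpNeg (f n c x z) ∂Γ c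
  have hm (n : ℕ) : Measurable (m n) := Finset.measurable_sum _ fun c _ =>
    (h.measurable_weight n c).mul (hexp n c).lintegral_prod_right'
  have hm1 (n : ℕ) (x : α) : m n x ≤ 1 := by
    refine (Finset.sum_le_sum fun c _ => mul_le_of_le_one_right' ?_).trans (hw n x)
    exact (lintegral_mono fun z => eexpNeg_le_one _).trans_eq (by simp)
  have hleft := tendsto_lintegral_of_le_one (μ := μ.restrict {ω | X ω ∈ B})
    (F := fun N ω => ∏ n ∈ Finset.range N, eexpNeg (f n (C n ω) (X ω) (Z n ω)))
    (fun N => Finset.measurable_prod _ fun n _ =>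
      measurable_eexpNeg.comp (h.measurable_apply (hf n) n))
    (fun N ω => Finset.prod_le_one' fun n _ => eexpNeg_le_one _)
    (ae_of_all _ fun ω => tendsto_eexpNeg_tsum _)
  have hright := tendsto_lintegral_of_le_one (μ := μ.restrict {ω | X ω ∈ B})
    (F := fun N ω => ∏ n ∈ Finset.range N, eexpNeg (enegLog (m n (X ω))))
    (fun N => by fun_prop) (fun N ω => Finset.prod_le_one' fun n _ => eexpNeg_le_one _)
    (ae_of_all _ fun ω => tendsto_eexpNeg_tsum _)
  refine tendsto_nhds_unique hleft (hright.congr fun N => ?_)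
  simp_rw [eexpNeg_enegLog (hm1 _ _)]
  exact (h.setLIntegral_prod hexp (fun n c x z => eexpNeg_le_one _) (Finset.range N) hB).symm

end IsConditionallyIndepMarking

end Marking

/-! ### Laplace transform of the interference given the positions -/

theorem lintegral_eexpNeg_gammaMeasure {N : ℕ} (hN : 1 ≤ N) {b : ℝ} (hb : 0 ≤ b) :
    ∫⁻ y, eexpNeg (ENNReal.ofReal (b * y)) ∂gammaMeasure N N =
      ENNReal.ofReal ((1 + b / N) ^ N)⁻¹ := by
  have hN0 : (0 : ℝ) < N := by exact_mod_cast hN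
  have htilt (y : ℝ) : gammaPDF N N y * eexpNeg (ENNReal.ofReal (b * y)) =
      ENNReal.ofReal ((1 + b / N) ^ N)⁻¹ * gammaPDF N (N + b) y := by
    rcases lt_or_ge y 0 with hy | hy
    · simp [gammaPDF_of_neg hy]
    rw [gammaPDF_of_nonneg hy, gammaPDF_of_nonneg hy, eexpNeg_ofReal (by positivity),
      ← ENNReal.ofReal_mul (by positivity), ← ENNReal.ofReal_mul (by positivity),
      one_add_div hN0.ne', div_pow, inv_div, Real.rpow_natCast, Real.rpow_natCast, add_mul,
      neg_add, Real.exp_add]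
    have : ((N : ℝ) + b) ^ N ≠ 0 := by positivity
    field_simp
  have hpdf (a r : ℝ) : Measurable (gammaPDF a r) := (measurable_gammaPDFReal a r).ennreal_ofReal
  rw [gammaMeasure, lintegral_withDensity_eq_lintegral_mul _ (hpdf _ _) (by fun_prop)]
  simp only [Pi.mul_apply, htilt]
  rw [lintegral_const_mul _ (hpdf _ _), lintegral_gammaPDF_eq_one hN0 (by positivity), mul_one]

instance : DiscreteMeasurableSpace Link := ⟨fun _ => trivial⟩

instance : Fintype Link :=
  ⟨⟨{Link.L, Link.N}, by simp⟩, fun κ => by cases κ <;> simp⟩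

theorem Link.sum_univ {M : Type*} [AddCommMonoid M] (f : Link → M) :
    ∑ κ, f κ = f Link.L + f Link.N := by
  simp [Finset.sum, Finset.univ, Fintype.elems]

theorem one_sub_exp_neg_mem_Icc {x : ℝ} (hx : 0 ≤ x) : 1 - Real.exp (-x) ∈ Set.Icc (0 : ℝ) 1 :=
  ⟨sub_nonneg.2 (Real.exp_le_one_iff.2 (neg_nonpos.2 hx)), sub_le_self _ (Real.exp_nonneg _)⟩

theorem beamProb_mem_Icc {x y : ℝ} (hx : x ∈ Set.Icc 0 (2 * Real.pi)) (hy : y ∈ Set.Icc 0 Real.pi) :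
    x / (2 * Real.pi) * (y / Real.pi) ∈ Set.Icc (0 : ℝ) 1 :=
  unitInterval.mul_mem (unitInterval.div_mem hx.1 Real.two_pi_pos.le hx.2)
    (unitInterval.div_mem hy.1 Real.pi_pos.le hy.2)

namespace DownlinkParams

variable {P : DownlinkParams}

theorem losProb_mem_Icc (P : DownlinkParams) (k : ℕ) : P.losProb k ∈ Set.Icc (0 : ℝ) 1 := by
  have hfactor (n : ℕ) : 1 - Real.exp (-((k * max P.hv P.hb - (n + 1 / 2) * P.dh) ^ 2 /
      (2 * P.eps ^ 2 * (k : ℝ) ^ 2))) ∈ Set.Icc (0 : ℝ) 1 :=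
    one_sub_exp_neg_mem_Icc (by positivity)
  unfold losProb
  split_ifs
  · simp
  · exact ⟨Finset.prod_nonneg fun n _ => (hfactor n).1,
      Finset.prod_le_one (fun n _ => (hfactor n).1) fun n _ => (hfactor n).2⟩

theorem linkProb_nonneg (P : DownlinkParams) (κ : Link) (k : ℕ) : 0 ≤ P.linkProb κ k := by
  cases κ
  · exact (P.losProb_mem_Icc k).1
  · exact sub_nonneg.2 (P.losProb_mem_Icc k).2

theorem sum_linkProb (P : DownlinkParams) (k : ℕ) : ∑ κ, P.linkProb κ k = 1 := by
  simp [Link.sum_univ, linkProb]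

theorem linkProb_le_one (P : DownlinkParams) (κ : Link) (k : ℕ) : P.linkProb κ k ≤ 1 :=
  (Finset.single_le_sum (fun κ _ => P.linkProb_nonneg κ k) (Finset.mem_univ κ)).trans_eq
    (P.sum_linkProb k)

theorem measurable_linkProb (P : DownlinkParams) (κ : Link) :
    Measurable fun r => P.linkProb κ (P.γ r) :=
  (measurable_from_nat (f := P.linkProb κ)).comp
    (Nat.measurable_floor.comp (measurable_id.mul_const P.rate))

theorem Admissible.gainProb_nonneg (hP : P.Admissible) (i : Fin 4) : 0 ≤ P.gainProb i := by
  have ht : P.qt ∈ Set.Icc (0 : ℝ) 1 := beamProb_mem_Icc hP.θta_mem hP.θte_mem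
  have hr : P.qr ∈ Set.Icc (0 : ℝ) 1 := beamProb_mem_Icc hP.θra_mem hP.θre_mem
  match i with
  | 0 => exact mul_nonneg ht.1 hr.1
  | 1 => exact mul_nonneg (sub_nonneg.2 ht.2) hr.1
  | 2 => exact mul_nonneg ht.1 (sub_nonneg.2 hr.2)
  | 3 => exact mul_nonneg (sub_nonneg.2 ht.2) (sub_nonneg.2 hr.2)

theorem sum_gainProb (P : DownlinkParams) : ∑ i, P.gainProb i = 1 := by
  simp only [gainProb, Fin.sum_univ_four, Matrix.cons_val]
  ring

theorem Admissible.gain_nonneg (hP : P.Admissible) (i : Fin 4) : 0 ≤ P.gain i :=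
  match i with
  | 0 => mul_nonneg hP.Mt_nonneg hP.Mr_nonneg
  | 1 => mul_nonneg hP.mt_nonneg hP.Mr_nonneg
  | 2 => mul_nonneg hP.Mt_nonneg hP.mr_nonneg
  | 3 => mul_nonneg hP.mt_nonneg hP.mr_nonneg

theorem Admissible.pathLoss_nonneg (hP : P.Admissible) (κ : Link) (r : ℝ) : 0 ≤ P.pathLoss κ r :=
  div_nonneg (hP.C_pos κ).le (Real.sqrt_nonneg _)

@[fun_prop]
theorem measurable_pathLoss (P : DownlinkParams) (κ : Link) : Measurable (P.pathLoss κ) := by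
  unfold pathLoss
  fun_prop

noncomputable section

/-- The Laplace transform at `s` of the power received over a link of horizontal length `r` in the
state `κ` with directivity gain `g`. -/
def linkLaplace (P : DownlinkParams) (κ : Link) (s g r : ℝ) : ℝ :=
  ((1 + s * (P.pathLoss κ r * g) / P.Nak κ) ^ P.Nak κ)⁻¹

/-- The Laplace transform at `s` of the power received from an interferer at horizontal distance
`r`, averaged over the link state and the directivity gain. -/
def markLaplace (P : DownlinkParams) (s r : ℝ) : ℝ :=
  ∑ i, P.gainProb i * ∑ κ, P.linkProb κ (P.γ r) * P.linkLaplace κ s (P.gain i) r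

end

@[fun_prop]
theorem measurable_linkLaplace (P : DownlinkParams) (κ : Link) (s g : ℝ) :
    Measurable (P.linkLaplace κ s g) := by
  unfold linkLaplace
  fun_prop

theorem measurable_markLaplace (P : DownlinkParams) (s : ℝ) : Measurable (P.markLaplace s) :=
  Finset.measurable_sum _ fun i _ => (Finset.measurable_sum _ fun κ _ =>
    (P.measurable_linkProb κ).mul (P.measurable_linkLaplace κ s (P.gain i))).const_mul _

theorem Admissible.linkLaplace_mem_Icc (hP : P.Admissible) (κ : Link) {s g : ℝ} (hs : 0 ≤ s)
    (hg : 0 ≤ g) (r : ℝ) : P.linkLaplace κ s g r ∈ Set.Icc (0 : ℝ) 1 := by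
  have hpower : 0 ≤ s * (P.pathLoss κ r * g) / P.Nak κ := by
    have := hP.pathLoss_nonneg κ r
    positivity
  have hone : 1 ≤ (1 + s * (P.pathLoss κ r * g) / P.Nak κ) ^ P.Nak κ :=
    one_le_pow₀ (le_add_of_nonneg_right hpower)
  exact ⟨inv_nonneg.2 (zero_le_one.trans hone), inv_le_one_of_one_le₀ hone⟩

theorem one_sub_markLaplace (P : DownlinkParams) (s r : ℝ) : 1 - P.markLaplace s r =
    ∑ i, P.gainProb i * ∑ κ, P.linkProb κ (P.γ r) * (1 - P.linkLaplace κ s (P.gain i) r) := by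
  simp only [mul_sub, mul_one, Finset.sum_sub_distrib, sum_linkProb, sum_gainProb, markLaplace]

theorem Admissible.markLaplace_nonneg (hP : P.Admissible) {s : ℝ} (hs : 0 ≤ s) (r : ℝ) :
    0 ≤ P.markLaplace s r :=
  Finset.sum_nonneg fun i _ => mul_nonneg (hP.gainProb_nonneg i) <| Finset.sum_nonneg fun κ _ =>
    mul_nonneg (P.linkProb_nonneg κ _) (hP.linkLaplace_mem_Icc κ hs (hP.gain_nonneg i) r).1

theorem Admissible.markLaplace_le_one (hP : P.Admissible) {s : ℝ} (hs : 0 ≤ s) (r : ℝ) :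
    P.markLaplace s r ≤ 1 := by
  rw [← sub_nonneg, one_sub_markLaplace]
  exact Finset.sum_nonneg fun i _ => mul_nonneg (hP.gainProb_nonneg i) <| Finset.sum_nonneg
    fun κ _ => mul_nonneg (P.linkProb_nonneg κ _)
      (sub_nonneg.2 (hP.linkLaplace_mem_Icc κ hs (hP.gain_nonneg i) r).2)

theorem Admissible.isProbabilityMeasure_gammaMeasure (hP : P.Admissible) (κ : Link) :
    IsProbabilityMeasure (gammaMeasure (P.Nak κ) (P.Nak κ)) := by
  have : (0 : ℝ) < P.Nak κ := by exact_mod_cast hP.Nak_pos κ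
  exact ProbabilityTheory.isProbabilityMeasure_gammaMeasure this this

theorem Admissible.sum_markProb (hP : P.Admissible) (k : ℕ) : ∑ c : Link × Fin 4,
    ENNReal.ofReal (P.linkProb c.1 k) * ENNReal.ofReal (P.gainProb c.2) = 1 := by
  simp_rw [Fintype.sum_prod_type, ← Finset.mul_sum,
    ← ENNReal.ofReal_sum_of_nonneg fun i _ => hP.gainProb_nonneg i, P.sum_gainProb,
    ENNReal.ofReal_one, mul_one, ← ENNReal.ofReal_sum_of_nonneg fun κ _ => P.linkProb_nonneg κ k,
    P.sum_linkProb, ENNReal.ofReal_one]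

theorem Admissible.sum_markProb_mul_lintegral (hP : P.Admissible) {s : ℝ} (hs : 0 ≤ s) (r : ℝ) :
    ∑ c : Link × Fin 4, ENNReal.ofReal (P.linkProb c.1 (P.γ r)) * ENNReal.ofReal (P.gainProb c.2) *
        ∫⁻ y, eexpNeg (ENNReal.ofReal s * ENNReal.ofReal (P.pathLoss c.1 r * P.gain c.2 * y))
          ∂gammaMeasure (P.Nak c.1) (P.Nak c.1) = ENNReal.ofReal (P.markLaplace s r) := by
  have hlaplace (c : Link × Fin 4) :
      ∫⁻ y, eexpNeg (ENNReal.ofReal s * ENNReal.ofReal (P.pathLoss c.1 r * P.gain c.2 * y))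
        ∂gammaMeasure (P.Nak c.1) (P.Nak c.1) =
      ENNReal.ofReal (P.linkLaplace c.1 s (P.gain c.2) r) := by
    simp_rw [← ENNReal.ofReal_mul hs, ← mul_assoc s (_ * _)]
    exact lintegral_eexpNeg_gammaMeasure (hP.Nak_pos c.1)
      (mul_nonneg hs (mul_nonneg (hP.pathLoss_nonneg _ _) (hP.gain_nonneg _)))
  have hnonneg (i : Fin 4) (κ : Link) :
      0 ≤ P.linkProb κ (P.γ r) * P.linkLaplace κ s (P.gain i) r :=
    mul_nonneg (P.linkProb_nonneg κ _) (hP.linkLaplace_mem_Icc κ hs (hP.gain_nonneg i) r).1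
  rw [markLaplace, ENNReal.ofReal_sum_of_nonneg fun i _ =>
    mul_nonneg (hP.gainProb_nonneg i) (Finset.sum_nonneg fun κ _ => hnonneg i κ),
    Fintype.sum_prod_type_right]
  refine Finset.sum_congr rfl fun i _ => ?_
  rw [ENNReal.ofReal_mul (hP.gainProb_nonneg i),
    ENNReal.ofReal_sum_of_nonneg fun κ _ => hnonneg i κ, Finset.mul_sum]
  refine Finset.sum_congr rfl fun κ _ => ?_
  rw [hlaplace, ENNReal.ofReal_mul (P.linkProb_nonneg κ _)]
  ring

end DownlinkParams

namespace IsDownlinkNetwork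

variable {Ω : Type*} [MeasurableSpace Ω] {μ : Measure Ω} {P : DownlinkParams}
  {v : ℕ → Ω → EuclideanSpace ℝ (Fin 2)} {link : ℕ → Ω → Link} {pat : ℕ → Ω → Fin 4}
  {fad : ℕ → Ω → ℝ}

theorem isConditionallyIndepMarking (hnet : IsDownlinkNetwork μ P v link pat fad) :
    IsConditionallyIndepMarking μ (fun ω n => v n ω) (fun n ω => (link n ω, pat n ω)) fad
      (fun n c x => ENNReal.ofReal (P.linkProb c.1 (P.γ ‖x (n + 1)‖)) *
        ENNReal.ofReal (P.gainProb c.2))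
      (fun c => gammaMeasure (P.Nak c.1) (P.Nak c.1)) where
  measurable_base := measurable_pi_lambda _ hnet.measurable_v
  measurable_state n := (hnet.measurable_link n).prodMk (hnet.measurable_pat n)
  measurable_value := hnet.measurable_fad
  measurable_weight n c :=
    ((P.measurable_linkProb c.1).comp (measurable_pi_apply (n + 1)).norm).ennreal_ofReal.mul_const _
  measure_rectangle B S c T hB hT := by
    simpa only [Prod.ext_iff, and_assoc] using
      hnet.marks B hB S (fun n => (c n).1) (fun n => (c n).2) T hT

theorem setLIntegral_interference [IsFiniteMeasure μ] (hnet : IsDownlinkNetwork μ P v link pat fad)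
    (hP : P.Admissible) {s : ℝ} (hs : 0 ≤ s) {B : Set (ℕ → EuclideanSpace ℝ (Fin 2))}
    (hB : MeasurableSet B) :
    ∫⁻ ω in {ω | (fun n => v n ω) ∈ B},
        eexpNeg (ENNReal.ofReal s * interference P v link pat fad ω) ∂μ =
      ∫⁻ ω in {ω | (fun n => v n ω) ∈ B},
        eexpNeg (∑' n, enegLog (ENNReal.ofReal (P.markLaplace s ‖v (n + 1) ω‖))) ∂μ := by
  have (c : Link × Fin 4) : IsProbabilityMeasure (gammaMeasure (P.Nak c.1) (P.Nak c.1)) :=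
    hP.isProbabilityMeasure_gammaMeasure c.1
  simp only [interference, ← ENNReal.tsum_mul_left, ← hP.sum_markProb_mul_lintegral hs]
  exact hnet.isConditionallyIndepMarking.setLIntegral_eexpNeg_tsum
    (f := fun n c x y => ENNReal.ofReal s *
      ENNReal.ofReal (P.pathLoss c.1 ‖x (n + 1)‖ * P.gain c.2 * y))
    (fun n x => (hP.sum_markProb _).le) (fun n c => by fun_prop) hB

end IsDownlinkNetwork

/-! ### Euler integrals on star-shaped domains -/

/-- The integral `∫₀¹ t ^ (-δ) h (t z) dt` along the segment from `0` to `z`. It turns a power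
series `∑ aₙ zⁿ` into `∑ aₙ / (n + 1 - δ) zⁿ`. -/
noncomputable def eulerIntegral (δ : ℝ) (h : ℂ → ℂ) (z : ℂ) : ℂ :=
  ∫ t in (0 : ℝ)..1, (t ^ (-δ) : ℝ) • h (t • z)

section EulerIntegral

variable {δ : ℝ} {h : ℂ → ℂ} {U : Set ℂ} {z : ℂ}

theorem intervalIntegrable_rpow_neg_smul (hδ : δ < 1) {g : ℝ → ℂ}
    (hg : ContinuousOn g (Set.Icc 0 1)) :
    IntervalIntegrable (fun t => (t ^ (-δ) : ℝ) • g t) volume 0 1 :=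
  (intervalIntegral.intervalIntegrable_rpow' (by linarith)).smul_continuousOn
    (by rwa [Set.uIcc_of_le zero_le_one])

theorem continuousOn_comp_smul_segment (hh : ContinuousOn h U) (hU : StarConvex ℝ 0 U)
    (hz : z ∈ U) : ContinuousOn (fun t : ℝ => h (t • z)) (Set.Icc 0 1) :=
  hh.comp (by fun_prop) fun _ ht => hU.smul_mem hz ht.1 ht.2

theorem rpow_neg_mul_self {t : ℝ} (ht : 0 < t) : t ^ (-δ) * t = t ^ (-(δ - 1)) := by
  rw [← Real.rpow_add_one ht.ne']
  ring_nf

theorem hasDerivAt_eulerIntegral (hδ : δ < 1) (hUo : IsOpen U) (hU : StarConvex ℝ 0 U)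
    (hh : DifferentiableOn ℂ h U) (hz : z ∈ U) :
    HasDerivAt (eulerIntegral δ h) (eulerIntegral (δ - 1) (deriv h) z) z := by
  have hh' : ContinuousOn (deriv h) U := (hh.deriv hUo).continuousOn
  obtain ⟨ε, hε, hball⟩ := Metric.nhds_basis_closedBall.mem_iff.1 (hUo.mem_nhds hz)
  obtain ⟨C, hC⟩ := (isCompact_Icc.prod (isCompact_closedBall z ε)).exists_bound_of_continuousOn
    (f := fun p : ℝ × ℂ => deriv h (p.1 • p.2)) (s := Set.Icc (0 : ℝ) 1 ×ˢ Metric.closedBall z ε)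
    (hh'.comp (by fun_prop) fun p hp => hU.smul_mem (hball hp.2) hp.1.1 hp.1.2)
  refine (intervalIntegral.hasDerivAt_integral_of_dominated_loc_of_deriv_le
    (F' := fun w t => (t ^ (-(δ - 1)) : ℝ) • deriv h (t • w))
    (bound := fun t => t ^ (-(δ - 1)) * C) (Metric.ball_mem_nhds z hε) ?_ ?_ ?_
    (.of_forall fun t ht w hw => ?_) ?_ (.of_forall fun t ht w hw => ?_)).2
  · filter_upwards [hUo.mem_nhds hz] with w hw
    exact (intervalIntegrable_rpow_neg_smul hδ
      (continuousOn_comp_smul_segment hh.continuousOn hU hw)).def'.aestronglyMeasurable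
  · exact intervalIntegrable_rpow_neg_smul hδ (continuousOn_comp_smul_segment hh.continuousOn hU hz)
  · exact (intervalIntegrable_rpow_neg_smul (by linarith)
      (continuousOn_comp_smul_segment hh' hU hz)).def'.aestronglyMeasurable
  · rw [Set.uIoc_of_le zero_le_one] at ht
    rw [norm_smul, Real.norm_of_nonneg (Real.rpow_nonneg ht.1.le _)]
    exact mul_le_mul_of_nonneg_left
      (hC (t, w) ⟨Set.Ioc_subset_Icc_self ht, Metric.ball_subset_closedBall hw⟩)
      (Real.rpow_nonneg ht.1.le _)
  · exact (intervalIntegral.intervalIntegrable_rpow' (by linarith)).mul_const C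
  · rw [Set.uIoc_of_le zero_le_one] at ht
    have hmem := hU.smul_mem (hball (Metric.ball_subset_closedBall hw)) ht.1.le ht.2
    have hcomp := ((hh.differentiableAt (hUo.mem_nhds hmem)).hasDerivAt.scomp w
      ((hasDerivAt_id w).const_smul t)).const_smul (t ^ (-δ))
    refine hcomp.congr_deriv ?_
    rw [← rpow_neg_mul_self ht.1, mul_smul, smul_assoc, one_smul]

theorem mul_eulerIntegral_deriv (hδ : δ < 1) (hUo : IsOpen U) (hU : StarConvex ℝ 0 U)
    (hh : DifferentiableOn ℂ h U) (hz : z ∈ U) :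
    z * eulerIntegral (δ - 1) (deriv h) z = h z - (1 - δ) * eulerIntegral δ h z := by
  have hcont := continuousOn_comp_smul_segment hh.continuousOn hU hz
  have hint := (intervalIntegrable_rpow_neg_smul hδ hcont).const_mul (1 - δ : ℂ)
  have hint' := (intervalIntegrable_rpow_neg_smul (δ := δ - 1) (by linarith)
    (continuousOn_comp_smul_segment (hh.deriv hUo).continuousOn hU hz)).const_mul z
  have hFTC := intervalIntegral.integral_eq_sub_of_hasDerivAt_of_le zero_le_one
    (f := fun t : ℝ => (t ^ (1 - δ) : ℝ) • h (t • z)) ?_ (fun t ht => ?_) (hint.add hint')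
  · rw [intervalIntegral.integral_add hint hint', intervalIntegral.integral_const_mul,
      intervalIntegral.integral_const_mul] at hFTC
    simp only [Real.one_rpow, one_smul, Real.zero_rpow (sub_pos.2 hδ).ne', zero_smul,
      sub_zero] at hFTC
    rw [← hFTC, eulerIntegral, eulerIntegral]
    ring
  · exact (continuousOn_id.rpow_const fun _ _ => .inr (sub_pos.2 hδ).le).smul hcont
  · have hd := (hh.differentiableAt (hUo.mem_nhds (hU.smul_mem hz ht.1.le ht.2.le))).hasDerivAt
    have hprod := (Real.hasDerivAt_rpow_const (p := 1 - δ) (.inl ht.1.ne')).smul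
      (hd.scomp t ((hasDerivAt_id t).smul_const z))
    refine hprod.congr_deriv ?_
    simp only [Function.comp_apply, id_eq, one_smul, smul_eq_mul, Complex.real_smul,
      neg_sub, show 1 - δ - 1 = -δ by ring]
    push_cast
    ring

theorem integral_rpow_neg_smul_pow (hδ : δ < 1) (a : ℂ) (n : ℕ) :
    ∫ t in (0 : ℝ)..1, (t ^ (-δ) : ℝ) • (a * (t • z) ^ n) = a / (n + 1 - δ) * z ^ n := by
  have hn : 0 < n - δ + 1 := by linarith [n.cast_nonneg (α := ℝ)]
  have hpow : ∀ t ∈ Set.uIoc (0 : ℝ) 1, (t ^ (-δ) : ℝ) • (a * (t • z) ^ n) =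
      ((t ^ (n - δ) : ℝ) : ℂ) * (a * z ^ n) := fun t ht => by
    rw [Set.uIoc_of_le zero_le_one] at ht
    rw [show (n : ℝ) - δ = -δ + n by ring, Real.rpow_add_natCast ht.1.ne', Complex.real_smul,
      Complex.real_smul]
    push_cast
    ring
  rw [intervalIntegral.integral_congr_ae (.of_forall hpow), intervalIntegral.integral_mul_const,
    intervalIntegral.integral_ofReal, integral_rpow (.inl (by linarith)), Real.one_rpow,
    Real.zero_rpow hn.ne']
  push_cast
  ring

theorem hasSum_eulerIntegral (hδ : δ < 1) {a : ℕ → ℂ}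
    (ha : ∀ u : ℂ, ‖u‖ < 1 → HasSum (fun n => a n * u ^ n) (h u)) (hz : ‖z‖ < 1) :
    HasSum (fun n => a n / (n + 1 - δ) * z ^ n) (eulerIntegral δ h z) := by
  have hsum := (ha z hz).summable.norm
  simp_rw [← integral_rpow_neg_smul_pow hδ]
  refine intervalIntegral.hasSum_integral_of_dominated_convergence
    (fun n t => t ^ (-δ) * ‖a n * z ^ n‖) (fun n => ?_) (fun n => .of_forall fun t ht => ?_)
    (.of_forall fun t _ => hsum.mul_left _) ?_ (.of_forall fun t ht => ?_)
  · exact (intervalIntegrable_rpow_neg_smul hδ (by fun_prop)).def'.aestronglyMeasurable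
  · rw [Set.uIoc_of_le zero_le_one] at ht
    rw [norm_smul, Real.norm_of_nonneg (Real.rpow_nonneg ht.1.le _), smul_pow, mul_smul_comm,
      norm_smul, norm_pow, Real.norm_of_nonneg ht.1.le]
    exact mul_le_mul_of_nonneg_left
      (mul_le_of_le_one_left (norm_nonneg _) (pow_le_one₀ ht.1.le ht.2))
      (Real.rpow_nonneg ht.1.le _)
  · simp_rw [tsum_mul_left]
    exact (intervalIntegral.intervalIntegrable_rpow' (by linarith)).mul_const _
  · rw [Set.uIoc_of_le zero_le_one] at ht
    refine (ha _ ?_).const_smul _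
    rw [norm_smul, Real.norm_of_nonneg ht.1.le]
    exact (mul_le_of_le_one_left (norm_nonneg _) ht.2).trans_lt hz

end EulerIntegral

/-! ### The hypergeometric function `₂F₁(-δ, N; 1 - δ; z)` -/

/-- The plane cut along `[1, ∞)`. -/
def cutPlane : Set ℂ := {z | 1 - z ∈ Complex.slitPlane}

theorem isOpen_cutPlane : IsOpen cutPlane :=
  Complex.isOpen_slitPlane.preimage (by fun_prop)

theorem starConvex_cutPlane : StarConvex ℝ 0 cutPlane := by
  refine starConvex_zero_iff.2 fun z (hz : 1 - z ∈ Complex.slitPlane) t ht0 ht1 => ?_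
  have := Complex.starConvex_one_slitPlane.add_smul_mem (y := -z)
    (by simpa only [← sub_eq_add_neg] using hz) ht0 ht1
  rwa [smul_neg, ← sub_eq_add_neg] at this

theorem zero_mem_cutPlane : (0 : ℂ) ∈ cutPlane := by simp [cutPlane]

theorem isPreconnected_cutPlane : IsPreconnected cutPlane :=
  (starConvex_cutPlane.isPathConnected zero_mem_cutPlane).isConnected.isPreconnected

theorem one_sub_ne_zero_of_mem_cutPlane {z : ℂ} (hz : z ∈ cutPlane) : 1 - z ≠ 0 :=
  Complex.slitPlane_ne_zero hz

theorem neg_ofReal_mem_cutPlane {x : ℝ} (hx : 0 ≤ x) : (-x : ℂ) ∈ cutPlane := by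
  refine Complex.mem_slitPlane_iff.2 (.inl ?_)
  simp only [Complex.sub_re, Complex.one_re, Complex.neg_re, Complex.ofReal_re]
  linarith

theorem hasDerivAt_inv_one_sub_pow (N : ℕ) {z : ℂ} (hz : z ∈ cutPlane) :
    HasDerivAt (fun u => ((1 - u) ^ N)⁻¹) (N * ((1 - z) ^ (N + 1))⁻¹) z := by
  have h0 := one_sub_ne_zero_of_mem_cutPlane hz
  refine ((((hasDerivAt_id z).const_sub 1).fun_pow N).fun_inv (pow_ne_zero _ h0)).congr_deriv ?_
  cases N
  · simp
  · rw [Nat.add_sub_cancel, id]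
    field_simp
    ring

theorem differentiableOn_const_mul_inv_one_sub_pow (c : ℂ) (N : ℕ) :
    DifferentiableOn ℂ (fun u => c * ((1 - u) ^ N)⁻¹) cutPlane := fun _ hz =>
  ((hasDerivAt_inv_one_sub_pow N hz).const_mul c).differentiableAt.differentiableWithinAt

/-- An integral representation of `₂F₁(-δ, N; 1 - δ; z)` on the cut plane. Subtracting `z` times
the Euler integral of the derivative multiplies the `n`-th coefficient of the power series of
`(1 - z)⁻ᴺ` by `1 - n / (n - δ) = -δ / (n - δ)`. -/
noncomputable def hypergeometricIntegral (δ : ℝ) (N : ℕ) (z : ℂ) : ℂ :=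
  ((1 - z) ^ N)⁻¹ - z * eulerIntegral δ (fun u => N * ((1 - u) ^ (N + 1))⁻¹) z

theorem hasDerivAt_hypergeometricIntegral {δ : ℝ} (hδ : δ < 1) (N : ℕ) {z : ℂ}
    (hz : z ∈ cutPlane) :
    HasDerivAt (hypergeometricIntegral δ N)
      (-δ * eulerIntegral δ (fun u => N * ((1 - u) ^ (N + 1))⁻¹) z) z := by
  have hh := differentiableOn_const_mul_inv_one_sub_pow N (N + 1)
  have hI := hasDerivAt_eulerIntegral hδ isOpen_cutPlane starConvex_cutPlane hh hz
  refine ((hasDerivAt_inv_one_sub_pow N hz).sub ((hasDerivAt_id z).mul hI)).congr_deriv ?_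
  rw [id, mul_eulerIntegral_deriv hδ isOpen_cutPlane starConvex_cutPlane hh hz]
  ring

theorem ascPochhammer_eval_neg_mul (δ : ℂ) (n : ℕ) :
    (ascPochhammer ℂ n).eval (-δ) * (n - δ) = -δ * (ascPochhammer ℂ n).eval (1 - δ) := by
  induction n with
  | zero => simp
  | succ n ih =>
    rw [ascPochhammer_succ_eval, ascPochhammer_succ_eval, neg_add_eq_sub, ih]
    push_cast
    ring

theorem ascPochhammer_eval_natCast_succ (M n : ℕ) :
    (ascPochhammer ℂ n).eval ((M + 1 : ℕ) : ℂ) = n.factorial * (n + M).choose M := by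
  rw [ascPochhammer_nat_eq_natCast_ascFactorial, Nat.ascFactorial_eq_factorial_mul_choose,
    add_comm M n, Nat.choose_symm_add]
  push_cast
  rfl

theorem natCast_sub_ofReal_ne_zero {δ : ℝ} (hδ : δ < 1) {n : ℕ} (hn : n ≠ 0) :
    (n : ℂ) - δ ≠ 0 := by
  have : δ < n := hδ.trans_le (by exact_mod_cast Nat.one_le_iff_ne_zero.2 hn)
  exact_mod_cast (sub_pos.2 this).ne'

theorem hypergeometric_coefficient {δ : ℝ} (hδ : δ < 1) (M n : ℕ) :
    (n.factorial : ℂ)⁻¹ * (ascPochhammer ℂ n).eval (-(δ : ℂ)) *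
      (ascPochhammer ℂ n).eval ((M + 1 : ℕ) : ℂ) * ((ascPochhammer ℂ n).eval (1 - (δ : ℂ)))⁻¹ =
      (n + M).choose M * (1 - n / (n - δ)) := by
  rcases eq_or_ne n 0 with rfl | hn
  · simp
  have hδn := natCast_sub_ofReal_ne_zero hδ hn
  have hpoch : (ascPochhammer ℂ n).eval (1 - (δ : ℂ)) ≠ 0 := by
    rw [Ne, ascPochhammer_eval_eq_zero_iff]
    rintro ⟨k, -, hk⟩
    have hk' : (k : ℝ) = -(1 - δ) := by exact_mod_cast hk
    linarith [k.cast_nonneg (α := ℝ)]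
  have hfact : (n.factorial : ℂ) ≠ 0 := by exact_mod_cast n.factorial_ne_zero
  rw [ascPochhammer_eval_natCast_succ, one_sub_div hδn]
  field_simp
  linear_combination ((n + M).choose M : ℂ) * ascPochhammer_eval_neg_mul δ n

theorem hasSum_inv_one_sub_pow (M : ℕ) {u : ℂ} (hu : ‖u‖ < 1) :
    HasSum (fun n : ℕ => ((n + M).choose M : ℂ) * u ^ n) ((1 - u) ^ (M + 1))⁻¹ := by
  simpa only [one_div] using hasSum_choose_mul_geometric_of_norm_lt_one M hu

theorem choose_add_succ_mul (M n : ℕ) :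
    (n + 1 + M).choose M * (n + 1) = (M + 1) * (n + (M + 1)).choose (M + 1) := by
  have h := Nat.choose_succ_right_eq (n + 1 + M) M
  rw [Nat.add_sub_cancel] at h
  rw [← h, mul_comm, add_assoc, add_comm 1 M]

theorem hasSum_hypergeometricIntegral {δ : ℝ} (hδ : δ < 1) (M : ℕ) {z : ℂ} (hz : ‖z‖ < 1) :
    HasSum (fun n : ℕ => ((n + M).choose M : ℂ) * (1 - n / (n - δ)) * z ^ n)
      (hypergeometricIntegral δ (M + 1) z) := by
  have hI := (hasSum_eulerIntegral hδ
    (a := fun n => ((M + 1 : ℕ) : ℂ) * ((n + (M + 1)).choose (M + 1) : ℕ)) (fun u hu => by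
      simp_rw [mul_assoc]
      exact (hasSum_inv_one_sub_pow (M + 1) hu).mul_left ((M + 1 : ℕ) : ℂ)) hz).mul_left z
  have hshift : HasSum (fun n : ℕ => ((n + M).choose M : ℂ) * (n / (n - δ)) * z ^ n)
      (z * eulerIntegral δ (fun u => (M + 1 : ℕ) * ((1 - u) ^ (M + 1 + 1))⁻¹) z) := by
    refine (hasSum_nat_add_iff' 1).1 ?_
    rw [Finset.sum_range_one, Nat.cast_zero, zero_div, mul_zero, zero_mul, sub_zero]
    refine hI.congr_fun fun n => ?_
    rw [← Nat.cast_mul, ← choose_add_succ_mul]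
    push_cast
    ring
  refine ((hasSum_inv_one_sub_pow M hz).sub hshift).congr_fun fun n => ?_
  ring

theorem isHypergeometricContinuation_hypergeometricIntegral {δ : ℝ} (hδ : δ < 1) (M : ℕ) :
    IsHypergeometricContinuation (-(δ : ℂ)) ((M + 1 : ℕ) : ℂ) (1 - (δ : ℂ))
      (hypergeometricIntegral δ (M + 1)) := by
  refine ⟨fun z hz =>
    (hasDerivAt_hypergeometricIntegral hδ _ hz).differentiableAt.differentiableWithinAt,
    fun z hz => ?_⟩
  rw [← (hasSum_hypergeometricIntegral hδ M (by simpa using hz)).tsum_eq]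
  simp only [ordinaryHypergeometric_eq_tsum, hypergeometric_coefficient hδ, smul_eq_mul]

theorem IsHypergeometricContinuation.eqOn {a b c : ℂ} {f g : ℂ → ℂ}
    (hf : IsHypergeometricContinuation a b c f) (hg : IsHypergeometricContinuation a b c g) :
    Set.EqOn f g cutPlane := by
  refine AnalyticOnNhd.eqOn_of_preconnected_of_eventuallyEq (hf.1.analyticOnNhd isOpen_cutPlane)
    (hg.1.analyticOnNhd isOpen_cutPlane) isPreconnected_cutPlane zero_mem_cutPlane ?_
  filter_upwards [Metric.ball_mem_nhds (0 : ℂ) one_pos] with z hz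
  rw [hf.2 hz, hg.2 hz]

theorem IsHypergeometricContinuation.eqOn_gaussHypergeometric {a b c : ℂ} {f : ℂ → ℂ}
    (hf : IsHypergeometricContinuation a b c f) :
    Set.EqOn (gaussHypergeometric a b c) f cutPlane := fun z hz => by
  have hex : ∃ f, IsHypergeometricContinuation a b c f := ⟨f, hf⟩
  rw [gaussHypergeometric, dif_pos hex]
  exact hex.choose_spec.eqOn hf hz

/-! ### The differential equation of `F_α` -/

theorem FGeneric_eq {α : ℝ} (hα : 2 < α) {N : ℕ} (hN : 1 ≤ N) {z : ℝ} (hz : 0 ≤ z) :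
    FGeneric α N z = (hypergeometricIntegral (2 / α) N (-z)).re - 1 := by
  obtain ⟨M, rfl⟩ := Nat.exists_eq_add_of_le' hN
  have hδ : 2 / α < 1 := (div_lt_one (by linarith)).2 hα
  rw [FGeneric, neg_div, Complex.ofReal_neg, Complex.ofReal_sub, Complex.ofReal_one,
    Complex.ofReal_neg z, (isHypergeometricContinuation_hypergeometricIntegral hδ
      M).eqOn_gaussHypergeometric (neg_ofReal_mem_cutPlane hz)]

theorem FGeneric_zero {α : ℝ} (hα : 2 < α) {N : ℕ} (hN : 1 ≤ N) : FGeneric α N 0 = 0 := by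
  simp [FGeneric_eq hα hN le_rfl, hypergeometricIntegral]

theorem hasDerivAt_FGeneric {α : ℝ} (hα : 2 < α) {N : ℕ} (hN : 1 ≤ N) {z : ℝ} (hz : 0 < z) :
    HasDerivAt (FGeneric α N) (2 / α / z * (FGeneric α N z + 1 - ((1 + z) ^ N)⁻¹)) z := by
  have hδ : 2 / α < 1 := (div_lt_one (by linarith)).2 hα
  have hJ := hasDerivAt_hypergeometricIntegral hδ N (neg_ofReal_mem_cutPlane hz.le)
  have hre := (hJ.scomp (z : ℂ) (hasDerivAt_neg (z : ℂ))).real_of_complex.sub_const 1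
  have heq : FGeneric α N =ᶠ[𝓝 z]
      fun x => ((hypergeometricIntegral (2 / α) N ∘ Neg.neg) (x : ℂ)).re - 1 := by
    filter_upwards [lt_mem_nhds hz] with x hx
    exact FGeneric_eq hα hN hx.le
  refine (hre.congr_of_eventuallyEq heq).congr_deriv ?_
  rw [FGeneric_eq hα hN hz.le, hypergeometricIntegral]
  generalize eulerIntegral _ _ _ = E
  have hpow : ((1 - -(z : ℂ)) ^ N)⁻¹ = ((((1 + z) ^ N)⁻¹ : ℝ) : ℂ) := by
    push_cast
    rw [sub_neg_eq_add]
  rw [hpow, neg_smul, one_smul, neg_mul, neg_neg, Complex.re_ofReal_mul, Complex.sub_re,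
    Complex.ofReal_re, ← Complex.ofReal_neg, Complex.re_ofReal_mul]
  field_simp
  ring

theorem FTwo_zero (N : ℕ) : FTwo N 0 = 0 := by simp [FTwo]

theorem FTwo_succ (M : ℕ) (z : ℝ) : FTwo (M + 1) z =
    z * (∑ d ∈ Finset.range M, ((M + 1 : ℕ) : ℝ) / ((z + 1) ^ (d + 1) * (d + 1))) +
      (1 - (z + 1) ^ M) / (z + 1) ^ M - z * ((M + 1 : ℕ) * Real.log (1 + 1 / z)) := by
  rw [FTwo, Nat.add_sub_cancel, Finset.mul_sum, mul_assoc z]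
  congr 2
  refine Finset.sum_nbij' (M - ·) (M - ·) ?_ ?_ ?_ ?_ fun c hc => ?_
  any_goals intro c hc; simp only [Finset.mem_Icc, Finset.mem_range] at hc ⊢; omega
  obtain ⟨-, hcM⟩ := Finset.mem_Icc.1 hc
  rw [Nat.succ_sub hcM, Nat.succ_eq_add_one, Nat.cast_sub hcM]
  push_cast
  ring

theorem mul_sum_inv_add_one_pow (M : ℕ) {z : ℝ} (hz : 0 < z) :
    z * ∑ d ∈ Finset.range M, ((z + 1) ^ (d + 2))⁻¹ = (z + 1)⁻¹ - ((z + 1) ^ (M + 1))⁻¹ := by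
  induction M with
  | zero => simp
  | succ n ih =>
    rw [Finset.sum_range_succ, mul_add, ih]
    field_simp
    ring

theorem hasDerivAt_inv_add_one_pow (n : ℕ) {z : ℝ} (hz : 0 < z) :
    HasDerivAt (fun y : ℝ => ((y + 1) ^ n)⁻¹) (-(n * ((z + 1) ^ (n + 1))⁻¹)) z := by
  refine ((((hasDerivAt_id z).add_const 1).fun_pow n).fun_inv (by positivity)).congr_deriv ?_
  cases n
  · simp
  · rw [Nat.add_sub_cancel, id]
    field_simp
    ring

theorem hasDerivAt_sum_div_add_one_pow (c : ℝ) (M : ℕ) {z : ℝ} (hz : 0 < z) :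
    HasDerivAt (fun y : ℝ => ∑ d ∈ Finset.range M, c / ((y + 1) ^ (d + 1) * (d + 1)))
      (-(c * ∑ d ∈ Finset.range M, ((z + 1) ^ (d + 2))⁻¹)) z := by
  rw [Finset.mul_sum, ← Finset.sum_neg_distrib]
  refine HasDerivAt.fun_sum fun d _ => ?_
  have hterm := (hasDerivAt_inv_add_one_pow (d + 1) hz).const_mul (c / (d + 1))
  refine (hterm.congr_deriv ?_).congr_of_eventuallyEq (.of_forall fun y => ?_)
  · push_cast
    field_simp
  · simp only [mul_comm ((y + 1) ^ (d + 1)), ← div_div, div_eq_mul_inv (c / _)]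

theorem hasDerivAt_one_sub_add_one_pow_div (M : ℕ) {z : ℝ} (hz : 0 < z) :
    HasDerivAt (fun y : ℝ => (1 - (y + 1) ^ M) / (y + 1) ^ M)
      (-(M * ((z + 1) ^ (M + 1))⁻¹)) z := by
  refine ((hasDerivAt_inv_add_one_pow M hz).sub_const 1).congr_of_eventuallyEq ?_
  filter_upwards [lt_mem_nhds hz] with y hy
  rw [sub_div, one_div, div_self (by positivity)]

theorem hasDerivAt_log_one_add_one_div {z : ℝ} (hz : 0 < z) :
    HasDerivAt (fun y : ℝ => Real.log (1 + 1 / y)) (-(1 / (z * (z + 1)))) z := by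
  have hinv : HasDerivAt (fun y : ℝ => 1 + 1 / y) (-(z ^ 2)⁻¹) z := by
    simpa only [one_div] using (hasDerivAt_inv hz.ne').const_add 1
  refine (hinv.log (by positivity)).congr_deriv ?_
  field_simp

theorem hasDerivAt_FTwo {N : ℕ} (hN : 1 ≤ N) {z : ℝ} (hz : 0 < z) :
    HasDerivAt (FTwo N) (1 / z * (FTwo N z + 1 - ((1 + z) ^ N)⁻¹)) z := by
  obtain ⟨M, rfl⟩ := Nat.exists_eq_add_of_le' hN
  have hF := (((hasDerivAt_id z).mul (hasDerivAt_sum_div_add_one_pow (M + 1 : ℕ) M hz)).add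
    (hasDerivAt_one_sub_add_one_pow_div M hz)).sub
      ((hasDerivAt_id z).mul ((hasDerivAt_log_one_add_one_div hz).const_mul ((M + 1 : ℕ) : ℝ)))
  refine (hF.congr_of_eventuallyEq (.of_forall (FTwo_succ M))).congr_deriv ?_
  have hgeom : ∑ d ∈ Finset.range M, ((z + 1) ^ (d + 2))⁻¹ =
      ((z + 1)⁻¹ - ((z + 1) ^ (M + 1))⁻¹) / z :=
    (eq_div_iff hz.ne').2 ((mul_comm _ _).trans (mul_sum_inv_add_one_pow M hz))
  rw [hgeom, FTwo_succ, id, add_comm 1 z]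
  push_cast
  field_simp
  ring

theorem hasDerivAt_FAlpha {α : ℝ} (hα : 2 ≤ α) {N : ℕ} (hN : 1 ≤ N) {z : ℝ} (hz : 0 < z) :
    HasDerivAt (FAlpha α N) (2 / α / z * (FAlpha α N z + 1 - ((1 + z) ^ N)⁻¹)) z := by
  unfold FAlpha
  rcases hα.eq_or_lt with rfl | hα
  · simpa only [if_true, div_self (two_ne_zero' ℝ)] using hasDerivAt_FTwo hN hz
  · simpa only [if_neg hα.ne'] using hasDerivAt_FGeneric hα hN hz

theorem FAlpha_zero {α : ℝ} (hα : 2 ≤ α) {N : ℕ} (hN : 1 ≤ N) : FAlpha α N 0 = 0 := by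
  rcases hα.eq_or_lt with rfl | hα
  · rw [FAlpha, if_pos rfl, FTwo_zero]
  · rw [FAlpha, if_neg hα.ne', FGeneric_zero hα hN]

/-! ### Integral representation of `Θ` -/

theorem hasDerivAt_half_mul_FAlpha {α : ℝ} (hα : 2 ≤ α) {N : ℕ} (hN : 1 ≤ N) {c y : ℝ}
    (hc : 0 ≤ c) (hy : 0 < y) :
    HasDerivAt (fun y => y / 2 * FAlpha α N (c / y ^ (α / 2)))
      (-(1 - ((1 + c / y ^ (α / 2)) ^ N)⁻¹) / 2) y := by
  rcases hc.eq_or_lt with rfl | hc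
  · simpa [FAlpha_zero hα hN] using hasDerivAt_const y (0 : ℝ)
  have hpow : 0 < y ^ (α / 2) := Real.rpow_pos_of_pos hy _
  have harg : HasDerivAt (fun y : ℝ => c / y ^ (α / 2)) (-(α / 2) * (c / y ^ (α / 2)) / y) y := by
    refine ((Real.hasDerivAt_rpow_const (p := α / 2) (Or.inl hy.ne')).fun_inv hpow.ne'
      |>.const_mul c).congr_deriv ?_
    rw [Real.rpow_sub_one hy.ne']
    field_simp
  have hz : 0 < c / y ^ (α / 2) := div_pos hc hpow
  refine (((hasDerivAt_id y).div_const 2).mul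
    ((hasDerivAt_FAlpha hα hN hz).comp y harg)).congr_deriv ?_
  have : α ≠ 0 := by positivity
  simp only [Function.comp_apply, id]
  field_simp
  ring

namespace DownlinkParams

variable {P : DownlinkParams} {κ : Link} {s g : ℝ}

theorem pathLoss_eq (P : DownlinkParams) (κ : Link) (r : ℝ) :
    P.pathLoss κ r = P.C κ / (r ^ 2 + P.dh ^ 2) ^ (P.α κ / 2) := by
  have hsq : 0 ≤ r ^ 2 + P.dh ^ 2 := by positivity
  rw [pathLoss, Real.sqrt_eq_rpow, ← Real.rpow_mul hsq, mul_one_div]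

theorem linkLaplace_eq (P : DownlinkParams) (κ : Link) (s g r : ℝ) : P.linkLaplace κ s g r =
    ((1 + s * P.C κ * g / P.Nak κ / (r ^ 2 + P.dh ^ 2) ^ (P.α κ / 2)) ^ P.Nak κ)⁻¹ := by
  rw [linkLaplace, pathLoss_eq]
  ring

theorem Admissible.hasDerivAt_ZPart (hP : P.Admissible) (hα : 2 ≤ P.α κ) (hs : 0 ≤ s)
    (hg : 0 ≤ g) {a : ℝ} (ha : 0 < a) :
    HasDerivAt (fun a => P.ZPart κ s a g) (-(a * (1 - P.linkLaplace κ s g a))) a := by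
  have hC := hP.C_pos κ
  have hsq : HasDerivAt (fun a : ℝ => a ^ 2 + P.dh ^ 2) (2 * a) a := by
    simpa using (hasDerivAt_pow 2 a).add_const (P.dh ^ 2)
  simp only [ZPart, ← div_div, linkLaplace_eq]
  refine ((hasDerivAt_half_mul_FAlpha hα (hP.Nak_pos κ) (by positivity)
    (by positivity)).comp a hsq).congr_deriv ?_
  ring

theorem Admissible.integrableOn_mul_one_sub_linkLaplace (hP : P.Admissible) (κ : Link)
    (hs : 0 ≤ s) (hg : 0 ≤ g) (a b : ℝ) :
    IntegrableOn (fun r => r * (1 - P.linkLaplace κ s g r)) (Set.Icc a b) := by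
  refine continuous_id.integrableOn_Icc.mul_bdd (c := 1) (by fun_prop) (ae_of_all _ fun r => ?_)
  obtain ⟨hnonneg, hle⟩ := hP.linkLaplace_mem_Icc κ hs hg r
  rw [Real.norm_of_nonneg (sub_nonneg.2 hle)]
  exact sub_le_self _ hnonneg

theorem Admissible.integrableOn_linkProb_mul (hP : P.Admissible) (κ : Link)
    (hs : 0 ≤ s) (hg : 0 ≤ g) (a b : ℝ) :
    IntegrableOn (fun r => P.linkProb κ (P.γ r) * (r * (1 - P.linkLaplace κ s g r)))
      (Set.Ico a b) := by
  refine ((hP.integrableOn_mul_one_sub_linkLaplace κ hs hg a b).mono_set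
    Set.Ico_subset_Icc_self).bdd_mul (c := 1) (P.measurable_linkProb κ).aestronglyMeasurable
    (ae_of_all _ fun r => ?_)
  rw [Real.norm_of_nonneg (P.linkProb_nonneg κ _)]
  exact P.linkProb_le_one κ _

theorem Admissible.Z_eq_integral (hP : P.Admissible) (hα : 2 ≤ P.α κ) (hs : 0 ≤ s)
    (hg : 0 ≤ g) {a b : ℝ} (ha : 0 < a) (hab : a ≤ b) :
    P.Z κ s a b g = ∫ r in a..b, r * (1 - P.linkLaplace κ s g r) := by
  have hderiv : ∀ r ∈ Set.uIcc a b, HasDerivAt (fun r => -P.ZPart κ s r g)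
      (r * (1 - P.linkLaplace κ s g r)) r := fun r hr => by
    rw [Set.uIcc_of_le hab] at hr
    simpa using (hP.hasDerivAt_ZPart hα hs hg (ha.trans_le hr.1)).fun_neg
  rw [intervalIntegral.integral_eq_sub_of_hasDerivAt hderiv
    ((intervalIntegrable_iff_integrableOn_Icc_of_le hab).2
      (hP.integrableOn_mul_one_sub_linkLaplace κ hs hg a b)), Z]
  ring

theorem Admissible.rate_pos (hP : P.Admissible) : 0 < P.rate :=
  Real.sqrt_pos.2 (mul_pos hP.betaA_pos hP.betaB_pos)

theorem Admissible.div_rate_le_div_rate (hP : P.Admissible) {x y : ℝ} (hxy : x ≤ y) :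
    x / P.rate ≤ y / P.rate :=
  div_le_div_of_nonneg_right hxy hP.rate_pos.le

theorem Admissible.γ_eq_iff (hP : P.Admissible) {j : ℕ} {r : ℝ} (hr : 0 ≤ r) :
    P.γ r = j ↔ r ∈ Set.Ico (j / P.rate) ((j + 1) / P.rate) := by
  rw [γ, Nat.floor_eq_iff (mul_nonneg hr hP.rate_pos.le), Set.mem_Ico, div_le_iff₀ hP.rate_pos,
    lt_div_iff₀ hP.rate_pos]

theorem Admissible.linkProb_mul_Z_eq_integral (hP : P.Admissible) (hα : 2 ≤ P.α κ)
    (hs : 0 ≤ s) (hg : 0 ≤ g) {a b : ℝ} (ha : 0 < a) (hab : a ≤ b) {j : ℕ}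
    (haj : j / P.rate ≤ a) (hbj : b ≤ (j + 1) / P.rate) :
    P.linkProb κ j * P.Z κ s a b g =
      ∫ r in Set.Ico a b, P.linkProb κ (P.γ r) * (r * (1 - P.linkLaplace κ s g r)) := by
  rw [hP.Z_eq_integral hα hs hg ha hab, intervalIntegral.integral_of_le hab,
    integral_Ioc_eq_integral_Ioo, ← integral_Ico_eq_integral_Ioo, ← integral_const_mul]
  refine setIntegral_congr_fun measurableSet_Ico fun r hr => ?_
  have hγ : P.γ r = j :=
    (hP.γ_eq_iff (ha.le.trans hr.1)).2 ⟨haj.trans hr.1, hr.2.trans_le hbj⟩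
  simp only [hγ]

theorem ThetaPartial_succ (P : DownlinkParams) (J : ℕ) (κ : Link) (s g r₁ : ℝ) :
    P.ThetaPartial (J + 1) κ s g r₁ =
      P.ThetaPartial J κ s g r₁ + P.thetaTerm κ s g (P.γ r₁ + 1 + J) := by
  simp only [ThetaPartial, Finset.sum_range_succ, add_assoc]

theorem Admissible.lt_γ_add_one_add_div_rate (hP : P.Admissible) {r₁ : ℝ} (hr : 0 < r₁) (J : ℕ) :
    r₁ < ((P.γ r₁ + 1 + J : ℕ) : ℝ) / P.rate := by
  refine ((hP.γ_eq_iff hr.le).1 rfl).2.trans_le (hP.div_rate_le_div_rate ?_)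
  push_cast
  exact le_add_of_nonneg_right J.cast_nonneg

theorem Admissible.ThetaPartial_eq_integral (hP : P.Admissible) (hα : 2 ≤ P.α κ)
    (hs : 0 ≤ s) (hg : 0 ≤ g) {r₁ : ℝ} (hr : 0 < r₁) (J : ℕ) :
    P.ThetaPartial J κ s g r₁ = ∫ r in Set.Ico r₁ (((P.γ r₁ + 1 + J : ℕ) : ℝ) / P.rate),
      P.linkProb κ (P.γ r) * (r * (1 - P.linkLaplace κ s g r)) := by
  induction J with
  | zero =>
    obtain ⟨hlower, hupper⟩ := (hP.γ_eq_iff hr.le).1 rfl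
    simpa [ThetaPartial, thetaHead] using
      hP.linkProb_mul_Z_eq_integral hα hs hg hr hupper.le hlower le_rfl
  | succ J ih =>
    have hinner := (hP.lt_γ_add_one_add_div_rate hr J).le
    have hannulus : ((P.γ r₁ + 1 + J : ℕ) : ℝ) / P.rate ≤
        (((P.γ r₁ + 1 + J : ℕ) : ℝ) + 1) / P.rate :=
      hP.div_rate_le_div_rate (le_add_of_nonneg_right zero_le_one)
    rw [ThetaPartial_succ, ih, thetaTerm, hP.linkProb_mul_Z_eq_integral hα hs hg
      (hr.trans_le hinner) hannulus le_rfl le_rfl, ← add_assoc _ J 1, Nat.cast_succ,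
      ← Set.Ico_union_Ico_eq_Ico hinner hannulus,
      setIntegral_union (Set.Ico_disjoint_Ico_same) measurableSet_Ico
        (hP.integrableOn_linkProb_mul κ hs hg _ _) (hP.integrableOn_linkProb_mul κ hs hg _ _)]

end DownlinkParams

/-! ### Convergence of the series -/

theorem one_sub_inv_one_add_pow_le (N : ℕ) {u : ℝ} (hu : 0 ≤ u) :
    1 - ((1 + u) ^ N)⁻¹ ≤ N * u := by
  have hinv : 1 - u ≤ (1 + u)⁻¹ := by
    rw [← one_div, le_div_iff₀ (by positivity)]
    nlinarith
  have hbernoulli : 1 + N * ((1 + u)⁻¹ - 1) ≤ ((1 + u) ^ N)⁻¹ := by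
    have hpos : 0 < (1 + u)⁻¹ := by positivity
    simpa using one_add_mul_le_pow (a := (1 + u)⁻¹ - 1) (by linarith) N
  nlinarith [N.cast_nonneg (α := ℝ)]

theorem abs_mul_sub_add_half_mul_le {m d : ℝ} (hm : 0 ≤ m) (hd : 0 ≤ d) {k n : ℕ} (hk : 1 ≤ k)
    (hn : n ≤ k) : |k * m - (n + 1 / 2) * d| ≤ k * (m + 2 * d) := by
  have hk' : (1 : ℝ) ≤ k := by exact_mod_cast hk
  have hn' : (n : ℝ) ≤ k := by exact_mod_cast hn
  rw [abs_le]
  constructor <;> nlinarith [n.cast_nonneg (α := ℝ)]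

namespace DownlinkParams

variable {P : DownlinkParams} {κ : Link} {s g : ℝ}

theorem dh_nonneg (P : DownlinkParams) : 0 ≤ P.dh := abs_nonneg _

theorem Admissible.exists_losProb_le (hP : P.Admissible) :
    ∃ q ∈ Set.Ico (0 : ℝ) 1, ∀ k : ℕ, 1 ≤ k → P.losProb k ≤ q ^ (k + 1) := by
  set B := (max P.hv P.hb + 2 * P.dh) ^ 2 / (2 * P.eps ^ 2)
  have hB : 0 ≤ B := by positivity
  have heps := hP.eps_pos
  refine ⟨1 - Real.exp (-B), ⟨(one_sub_exp_neg_mem_Icc hB).1, sub_lt_self _ (Real.exp_pos _)⟩,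
    fun k hk => ?_⟩
  rw [losProb, if_neg (by lia), Finset.pow_eq_prod_const _ (k + 1)]
  refine Finset.prod_le_prod (fun n _ => (one_sub_exp_neg_mem_Icc (by positivity)).1) fun n hn => ?_
  have hmax : 0 ≤ max P.hv P.hb := hP.hv_nonneg.trans (le_max_left _ _)
  obtain ⟨hlower, hupper⟩ := abs_le.1 <|
    abs_mul_sub_add_half_mul_le hmax P.dh_nonneg hk (Finset.mem_range_succ_iff.1 hn)
  have hexponent : (k * max P.hv P.hb - (n + 1 / 2) * P.dh) ^ 2 / (2 * P.eps ^ 2 * (k : ℝ) ^ 2) ≤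
      B := by
    calc _ ≤ (k * (max P.hv P.hb + 2 * P.dh)) ^ 2 / (2 * P.eps ^ 2 * (k : ℝ) ^ 2) :=
          div_le_div_of_nonneg_right (sq_le_sq' hlower hupper) (by positivity)
      _ = B := by
          have : (k : ℝ) ≠ 0 := by exact_mod_cast (by lia : k ≠ 0)
          simp only [B]
          field_simp
  exact sub_le_sub_left (Real.exp_le_exp.2 (neg_le_neg hexponent)) 1

theorem Admissible.pathLoss_le (hP : P.Admissible) (hα : 0 ≤ P.α κ) {r : ℝ} (hr : 0 < r) :
    P.pathLoss κ r ≤ P.C κ * r ^ (-P.α κ) := by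
  have hpow : r ^ P.α κ ≤ (r ^ 2 + P.dh ^ 2) ^ (P.α κ / 2) := by
    calc r ^ P.α κ = (r ^ 2) ^ (P.α κ / 2) := by
          rw [← Real.rpow_natCast_mul hr.le]
          congr 1
          push_cast
          ring
      _ ≤ (r ^ 2 + P.dh ^ 2) ^ (P.α κ / 2) := by gcongr; exact le_add_of_nonneg_right (sq_nonneg _)
  rw [pathLoss_eq, Real.rpow_neg hr.le, ← div_eq_mul_inv]
  exact div_le_div_of_nonneg_left (hP.C_pos κ).le (Real.rpow_pos_of_pos hr _) hpow

theorem Admissible.mul_one_sub_linkLaplace_le (hP : P.Admissible) (hα : 0 ≤ P.α κ) (hs : 0 ≤ s)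
    (hg : 0 ≤ g) {r : ℝ} (hr : 0 < r) :
    r * (1 - P.linkLaplace κ s g r) ≤ s * P.C κ * g * r ^ (1 - P.α κ) := by
  have hN : (P.Nak κ : ℝ) ≠ 0 := by exact_mod_cast Nat.one_le_iff_ne_zero.1 (hP.Nak_pos κ)
  have hpower : 0 ≤ s * (P.pathLoss κ r * g) / P.Nak κ := by
    have := hP.pathLoss_nonneg κ r
    positivity
  calc r * (1 - P.linkLaplace κ s g r)
      ≤ r * (P.Nak κ * (s * (P.pathLoss κ r * g) / P.Nak κ)) :=
        mul_le_mul_of_nonneg_left (one_sub_inv_one_add_pow_le _ hpower) hr.le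
    _ = r * (s * (P.pathLoss κ r * g)) := by rw [mul_div_cancel₀ _ hN]
    _ ≤ r * (s * (P.C κ * r ^ (-P.α κ) * g)) := by gcongr; exact hP.pathLoss_le hα hr
    _ = s * P.C κ * g * r ^ (1 - P.α κ) := by
        rw [sub_eq_add_neg, Real.rpow_add hr, Real.rpow_one]
        ring

theorem Admissible.thetaTerm_nonneg (hP : P.Admissible) (hα : 2 ≤ P.α κ) (hs : 0 ≤ s)
    (hg : 0 ≤ g) {j : ℕ} (hj : 1 ≤ j) : 0 ≤ P.thetaTerm κ s g j := by
  have hinner : 0 < j / P.rate := div_pos (by exact_mod_cast hj) hP.rate_pos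
  have hannulus : j / P.rate ≤ (j + 1) / P.rate :=
    hP.div_rate_le_div_rate (le_add_of_nonneg_right zero_le_one)
  rw [thetaTerm, hP.Z_eq_integral hα hs hg hinner hannulus]
  exact mul_nonneg (P.linkProb_nonneg κ j) (intervalIntegral.integral_nonneg hannulus fun r hr =>
    mul_nonneg (hinner.le.trans hr.1) (sub_nonneg.2 (hP.linkLaplace_mem_Icc κ hs hg r).2))

theorem Admissible.thetaTerm_le (hP : P.Admissible) (hα : 2 ≤ P.α κ) (hs : 0 ≤ s)
    (hg : 0 ≤ g) {j : ℕ} (hj : 1 ≤ j) {K : ℝ}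
    (hK : ∀ r ∈ Set.Icc (j / P.rate) ((j + 1) / P.rate), r * (1 - P.linkLaplace κ s g r) ≤ K) :
    P.thetaTerm κ s g j ≤ P.linkProb κ j * (K / P.rate) := by
  have hinner : 0 < j / P.rate := div_pos (by exact_mod_cast hj) hP.rate_pos
  have hannulus : j / P.rate ≤ (j + 1) / P.rate :=
    hP.div_rate_le_div_rate (le_add_of_nonneg_right zero_le_one)
  rw [thetaTerm, hP.Z_eq_integral hα hs hg hinner hannulus]
  refine mul_le_mul_of_nonneg_left ?_ (P.linkProb_nonneg κ j)
  calc ∫ r in j / P.rate..(j + 1) / P.rate, r * (1 - P.linkLaplace κ s g r)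
      ≤ ∫ _ in j / P.rate..(j + 1) / P.rate, K :=
        intervalIntegral.integral_mono_on hannulus
          ((intervalIntegrable_iff_integrableOn_Icc_of_le hannulus).2
            (hP.integrableOn_mul_one_sub_linkLaplace κ hs hg _ _)) intervalIntegrable_const hK
    _ = K / P.rate := by
        rw [intervalIntegral.integral_const, smul_eq_mul]
        ring

theorem Admissible.summable_thetaTerm_of_le (hP : P.Admissible) (hα : 2 ≤ P.α κ) (hs : 0 ≤ s)
    (hg : 0 ≤ g) {b : ℕ → ℝ} (hb : Summable b) (hle : ∀ j, 1 ≤ j → P.thetaTerm κ s g j ≤ b j) :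
    Summable (P.thetaTerm κ s g) := by
  refine hb.of_norm_bounded_eventually_nat ?_
  filter_upwards [eventually_ge_atTop 1] with j hj
  rw [Real.norm_of_nonneg (hP.thetaTerm_nonneg hα hs hg hj)]
  exact hle j hj

theorem Admissible.summable_thetaTerm_L (hP : P.Admissible) (hα : 2 ≤ P.α Link.L) (hs : 0 ≤ s)
    (hg : 0 ≤ g) : Summable (P.thetaTerm Link.L s g) := by
  obtain ⟨q, ⟨hq0, hq1⟩, hlos⟩ := hP.exists_losProb_le
  have hrate := hP.rate_pos
  have hgeom : Summable fun j : ℕ => q ^ (j + 1) * ((j + 1) / P.rate / P.rate) := by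
    have := (summable_nat_add_iff 1).2 (summable_pow_mul_geometric_of_norm_lt_one 1 (r := q)
      (by rwa [Real.norm_of_nonneg hq0]))
    refine (this.mul_right (1 / P.rate / P.rate)).congr fun j => ?_
    push_cast
    ring
  refine hP.summable_thetaTerm_of_le hα hs hg hgeom fun j hj => ?_
  refine (hP.thetaTerm_le hα hs hg hj (K := (j + 1) / P.rate) fun r hr => ?_).trans
    (mul_le_mul_of_nonneg_right (hlos j hj) (by positivity))
  have hr0 : 0 ≤ r := le_trans (by positivity) hr.1
  exact (mul_le_of_le_one_right hr0
    (sub_le_self _ (hP.linkLaplace_mem_Icc _ hs hg r).1)).trans hr.2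

theorem Admissible.summable_thetaTerm_of_two_lt (hP : P.Admissible) (hα : 2 < P.α κ) (hs : 0 ≤ s)
    (hg : 0 ≤ g) : Summable (P.thetaTerm κ s g) := by
  have hrate := hP.rate_pos
  have hpower : Summable fun j : ℕ => s * P.C κ * g * (j / P.rate) ^ (1 - P.α κ) / P.rate := by
    simp_rw [Real.div_rpow (Nat.cast_nonneg _) hrate.le]
    exact (((Real.summable_nat_rpow.2 (by linarith)).div_const _).mul_left _).div_const _
  refine hP.summable_thetaTerm_of_le hα.le hs hg hpower fun j hj => ?_
  have hinner : 0 < j / P.rate := div_pos (by exact_mod_cast hj) hrate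
  have hC := hP.C_pos κ
  refine (hP.thetaTerm_le hα.le hs hg hj fun r hr => ?_).trans
    (mul_le_of_le_one_left (by positivity) (P.linkProb_le_one κ j))
  refine (hP.mul_one_sub_linkLaplace_le (by linarith) hs hg (hinner.trans_le hr.1)).trans ?_
  exact mul_le_mul_of_nonneg_left
    (Real.rpow_le_rpow_of_nonpos hinner hr.1 (by linarith)) (by positivity)

theorem tendsto_ThetaPartial (h : Summable (P.thetaTerm κ s g)) (r₁ : ℝ) :
    Tendsto (fun J => P.ThetaPartial J κ s g r₁) atTop (𝓝 (P.Theta κ s g r₁)) :=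
  (h.comp_injective (add_right_injective _)).hasSum.tendsto_sum_nat.const_add _

end DownlinkParams

/-! ### The conditional Laplace transform as an integral over the plane -/

theorem integral_annulus_norm (f : ℝ → ℝ) {a : ℝ} (ha : 0 ≤ a) (b : ℝ) :
    ∫ x in {x : EuclideanSpace ℝ (Fin 2) | ‖x‖ ∈ Set.Ioo a b}, f ‖x‖ =
      2 * Real.pi * ∫ r in Set.Ico a b, r * f r := by
  have hball : volume.real (Metric.ball (0 : EuclideanSpace ℝ (Fin 2)) 1) = Real.pi := by
    simp [measureReal_def, EuclideanSpace.volume_ball_fin_two, Real.pi_nonneg]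
  have hradial (y : ℝ) : y ^ (2 - 1) • (Set.Ioo a b).indicator f y =
      (Set.Ioo a b).indicator (fun r => r * f r) y := by
    by_cases hy : y ∈ Set.Ioo a b <;> simp [hy]
  have hpositive : Set.Ioo a b ⊆ Set.Ioi 0 := fun y hy => ha.trans_lt hy.1
  calc ∫ x in {x : EuclideanSpace ℝ (Fin 2) | ‖x‖ ∈ Set.Ioo a b}, f ‖x‖
      = ∫ x : EuclideanSpace ℝ (Fin 2), (Set.Ioo a b).indicator f ‖x‖ :=
        (integral_indicator (measurable_norm measurableSet_Ioo)).symm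
    _ = 2 * Real.pi * ∫ y in Set.Ioi 0, y ^ (2 - 1) • (Set.Ioo a b).indicator f y := by
        simp [integral_fun_norm_addHaar, hball, mul_assoc]
    _ = 2 * Real.pi * ∫ r in Set.Ico a b, r * f r := by
        simp_rw [hradial]
        rw [setIntegral_indicator measurableSet_Ioo, integral_Ico_eq_integral_Ioo,
          Set.inter_eq_right.2 hpositive]

theorem setLIntegral_annulus_norm {f : ℝ → ℝ} (hf : Measurable f) (hmem : ∀ r, f r ∈ Set.Icc 0 1)
    {lam : ℝ} (hlam : 0 ≤ lam) {a : ℝ} (ha : 0 ≤ a) (b : ℝ) :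
    ∫⁻ x in {x : EuclideanSpace ℝ (Fin 2) | ‖x‖ ∈ Set.Ioo a b}, ENNReal.ofReal (f ‖x‖)
        ∂(ENNReal.ofReal lam • volume) =
      ENNReal.ofReal (2 * Real.pi * lam * ∫ r in Set.Ico a b, r * f r) := by
  have hfinite : volume {x : EuclideanSpace ℝ (Fin 2) | ‖x‖ ∈ Set.Ioo a b} ≠ ∞ :=
    ne_top_of_le_ne_top (measure_ball_lt_top (x := 0) (r := b)).ne
      (measure_mono fun x hx => mem_ball_zero_iff.2 hx.2)
  have hint : IntegrableOn (fun x : EuclideanSpace ℝ (Fin 2) => f ‖x‖)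
      {x | ‖x‖ ∈ Set.Ioo a b} := by
    refine Measure.integrableOn_of_bounded (M := 1) hfinite
      (hf.comp measurable_norm).aestronglyMeasurable (ae_of_all _ fun x => ?_)
    rw [Real.norm_of_nonneg (hmem _).1]
    exact (hmem _).2
  rw [Measure.restrict_smul, lintegral_smul_measure, ← ofReal_integral_eq_lintegral_ofReal hint
    (ae_of_all _ fun x => (hmem _).1), integral_annulus_norm f ha, smul_eq_mul,
    ← ENNReal.ofReal_mul hlam]
  ring_nf

theorem tendsto_setLIntegral_annulus {E : Type*} [NormedAddCommGroup E] [MeasurableSpace E]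
    (Λ : Measure E) (g : E → ℝ≥0∞) (a : ℝ) {b : ℕ → ℝ} (hmono : Monotone b)
    (hb : Tendsto b atTop atTop) :
    Tendsto (fun J => ∫⁻ x in {x | ‖x‖ ∈ Set.Ioo a (b J)}, g x ∂Λ) atTop
      (𝓝 (∫⁻ x in {x | a < ‖x‖}, g x ∂Λ)) := by
  have hunion : {x : E | a < ‖x‖} = ⋃ J, {x | ‖x‖ ∈ Set.Ioo a (b J)} := by
    ext x
    simpa using fun _ => (hb.eventually_gt_atTop ‖x‖).exists
  have hsubset : Monotone fun J => {x : E | ‖x‖ ∈ Set.Ioo a (b J)} := fun _ _ hmn _ hx =>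
    ⟨hx.1, hx.2.trans_le (hmono hmn)⟩
  rw [hunion, setLIntegral_iUnion_of_directed g hsubset.directed_le]
  exact tendsto_atTop_iSup fun _ _ hmn => lintegral_mono_set (hsubset hmn)

namespace DownlinkParams

variable {P : DownlinkParams}

/-- The exponent of the Laplace transform at `s` of the interference from all UAVs at horizontal
distance more than `t`. It is `[0, ∞]`-valued because it may be infinite when `P.α Link.N = 2`. -/
noncomputable def laplaceExponent (P : DownlinkParams) (s t : ℝ) : ℝ≥0∞ :=
  ∫⁻ x in {x : EuclideanSpace ℝ (Fin 2) | t < ‖x‖}, ENNReal.ofReal (1 - P.markLaplace s ‖x‖)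
    ∂(ENNReal.ofReal P.lam • volume)

theorem antitone_laplaceExponent (P : DownlinkParams) (s : ℝ) : Antitone (P.laplaceExponent s) :=
  fun _ _ hst => lintegral_mono_set fun _ hx => hst.trans_lt hx

@[fun_prop] theorem measurable_laplaceExponent (P : DownlinkParams) (s : ℝ) :
    Measurable (P.laplaceExponent s) :=
  (P.antitone_laplaceExponent s).measurable

theorem Admissible.sum_ThetaPartial_eq (hP : P.Admissible) (hα : ∀ κ, 2 ≤ P.α κ) {s r₁ : ℝ}
    (hs : 0 ≤ s) (hr : 0 < r₁) (J : ℕ) :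
    ∑ i : Fin 4, P.gainProb i * (P.ThetaPartial J Link.L s (P.gain i) r₁ +
      P.ThetaPartial J Link.N s (P.gain i) r₁) =
      ∫ r in Set.Ico r₁ (((P.γ r₁ + 1 + J : ℕ) : ℝ) / P.rate), r * (1 - P.markLaplace s r) := by
  have hsplit (r : ℝ) : r * (1 - P.markLaplace s r) = ∑ i, P.gainProb i *
      ∑ κ, P.linkProb κ (P.γ r) * (r * (1 - P.linkLaplace κ s (P.gain i) r)) := by
    simp only [one_sub_markLaplace, Finset.mul_sum]
    exact Finset.sum_congr rfl fun i _ => Finset.sum_congr rfl fun κ _ => by ring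
  have hint (i : Fin 4) (κ : Link) :=
    hP.integrableOn_linkProb_mul κ hs (hP.gain_nonneg i) r₁ (((P.γ r₁ + 1 + J : ℕ) : ℝ) / P.rate)
  simp_rw [hsplit]
  rw [integral_finsetSum _ fun i _ =>
    (integrable_finsetSum _ fun κ _ => hint i κ).const_mul _]
  refine Finset.sum_congr rfl fun i _ => ?_
  rw [integral_const_mul, integral_finsetSum _ fun κ _ => hint i κ, Link.sum_univ,
    hP.ThetaPartial_eq_integral (hα _) hs (hP.gain_nonneg i) hr,
    hP.ThetaPartial_eq_integral (hα _) hs (hP.gain_nonneg i) hr]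

theorem Admissible.exp_sum_ThetaPartial_eq (hP : P.Admissible) (hα : ∀ κ, 2 ≤ P.α κ)
    {s r₁ : ℝ} (hs : 0 ≤ s) (hr : 0 < r₁) (J : ℕ) :
    Real.exp (-2 * Real.pi * P.lam * ∑ i : Fin 4, P.gainProb i *
        (P.ThetaPartial J Link.L s (P.gain i) r₁ + P.ThetaPartial J Link.N s (P.gain i) r₁)) =
      (eexpNeg (∫⁻ x in {x : EuclideanSpace ℝ (Fin 2) |
          ‖x‖ ∈ Set.Ioo r₁ (((P.γ r₁ + 1 + J : ℕ) : ℝ) / P.rate)},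
        ENNReal.ofReal (1 - P.markLaplace s ‖x‖) ∂(ENNReal.ofReal P.lam • volume))).toReal := by
  have hmem (r : ℝ) : 1 - P.markLaplace s r ∈ Set.Icc 0 1 :=
    ⟨sub_nonneg.2 (hP.markLaplace_le_one hs r), sub_le_self _ (hP.markLaplace_nonneg hs r)⟩
  have hintegral : 0 ≤ ∫ r in Set.Ico r₁ (((P.γ r₁ + 1 + J : ℕ) : ℝ) / P.rate),
      r * (1 - P.markLaplace s r) :=
    setIntegral_nonneg measurableSet_Ico fun r hr' => mul_nonneg (hr.le.trans hr'.1) (hmem r).1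
  have hlam := hP.lam_pos.le
  have hmeas : Measurable fun r => 1 - P.markLaplace s r :=
    measurable_const.sub (P.measurable_markLaplace s)
  rw [setLIntegral_annulus_norm hmeas hmem hlam hr.le, eexpNeg_ofReal (by positivity),
    ENNReal.toReal_ofReal (Real.exp_pos _).le, hP.sum_ThetaPartial_eq hα hs hr]
  ring_nf

theorem Admissible.tendsto_exp_sum_ThetaPartial (hP : P.Admissible) (hα : ∀ κ, 2 ≤ P.α κ)
    {s r₁ : ℝ} (hs : 0 ≤ s) (hr : 0 < r₁) :
    Tendsto (fun J : ℕ => Real.exp (-2 * Real.pi * P.lam * ∑ i : Fin 4, P.gainProb i *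
        (P.ThetaPartial J Link.L s (P.gain i) r₁ + P.ThetaPartial J Link.N s (P.gain i) r₁)))
      atTop (𝓝 (expNeg (P.laplaceExponent s r₁))) := by
  simp_rw [hP.exp_sum_ThetaPartial_eq hα hs hr, ← toReal_eexpNeg]
  refine (ENNReal.tendsto_toReal (eexpNeg_ne_top _)).comp ((continuous_eexpNeg.tendsto _).comp
    (tendsto_setLIntegral_annulus _ _ r₁ ?_ ?_))
  · exact fun m n hmn => hP.div_rate_le_div_rate (by gcongr)
  · exact (tendsto_natCast_atTop_atTop.comp
      (tendsto_atTop_mono (fun J => Nat.le_add_left J _) tendsto_id)).atTop_div_const hP.rate_pos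

end DownlinkParams

namespace IsDownlinkNetwork

variable {Ω : Type*} [MeasurableSpace Ω] {μ : Measure Ω} {P : DownlinkParams}
  {v : ℕ → Ω → EuclideanSpace ℝ (Fin 2)} {link : ℕ → Ω → Link} {pat : ℕ → Ω → Fin 4}
  {fad : ℕ → Ω → ℝ}

theorem ae_norm_nearest_pos (hnet : IsDownlinkNetwork μ P v link pat fad) :
    ∀ᵐ ω ∂μ, 0 < ‖v 0 ω‖ := by
  filter_upwards [hnet.poisson.ae_count_eq_zero (measurableSet_singleton 0) (by simp)] with ω hω
  have hnearest : Measure.dirac (v 0 ω) {0} = 0 := Measure.sum_apply_eq_zero.1 hω 0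
  exact norm_pos_iff.2 fun hzero => by simp [hzero] at hnearest

theorem measurable_interference (hnet : IsDownlinkNetwork μ P v link pat fad) :
    Measurable (interference P v link pat fad) := by
  refine Measurable.tsum fun n => ENNReal.measurable_ofReal.comp ?_
  have hpathLoss : Measurable fun z : ℝ × Link => P.pathLoss z.2 z.1 :=
    measurable_from_prod_countable_left fun κ => P.measurable_pathLoss κ
  exact ((hpathLoss.comp ((hnet.measurable_v (n + 1)).norm.prodMk (hnet.measurable_link n))).mul
    ((measurable_of_finite P.gain).comp (hnet.measurable_pat n))).mul (hnet.measurable_fad n)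

theorem setIntegral_expNeg_interference [IsFiniteMeasure μ]
    (hnet : IsDownlinkNetwork μ P v link pat fad) (hP : P.Admissible) {s : ℝ} (hs : 0 ≤ s)
    {A : Set ℝ} (hA : MeasurableSet A) :
    ∫ ω in {ω | ‖v 0 ω‖ ∈ A}, expNeg (ENNReal.ofReal s * interference P v link pat fad ω) ∂μ =
      ∫ ω in {ω | ‖v 0 ω‖ ∈ A}, expNeg (P.laplaceExponent s ‖v 0 ω‖) ∂μ := by
  have : SigmaFinite (ENNReal.ofReal P.lam • (volume : Measure (EuclideanSpace ℝ (Fin 2)))) :=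
    inferInstanceAs (SigmaFinite (P.lam.toNNReal • volume))
  have hlog : Measurable fun x : EuclideanSpace ℝ (Fin 2) =>
      enegLog (ENNReal.ofReal (P.markLaplace s ‖x‖)) :=
    measurable_enegLog.comp ((P.measurable_markLaplace s).comp measurable_norm).ennreal_ofReal
  have hmark (r : ℝ) : 1 - eexpNeg (enegLog (ENNReal.ofReal (P.markLaplace s r))) =
      ENNReal.ofReal (1 - P.markLaplace s r) := by
    rw [eexpNeg_enegLog (ENNReal.ofReal_le_one.2 (hP.markLaplace_le_one hs r)),
      ENNReal.ofReal_sub _ (hP.markLaplace_nonneg hs r), ENNReal.ofReal_one]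
  have hnearest := hnet.poisson.setLIntegral_nearest hnet.measurable_v hnet.ranked hlog hA
  simp_rw [hmark] at hnearest
  have hexponent : Measurable fun ω => P.laplaceExponent s ‖v 0 ω‖ :=
    (P.measurable_laplaceExponent s).comp (hnet.measurable_v 0).norm
  rw [integral_expNeg (hnet.measurable_interference.const_mul _), integral_expNeg hexponent]
  refine Eq.trans ?_ (congrArg _ hnearest)
  exact congrArg _ (hnet.setLIntegral_interference hP hs (B := {x | ‖x 0‖ ∈ A})
    ((measurable_pi_apply 0).norm hA))

theorem condLaplace_ae_eq [IsFiniteMeasure μ] (hnet : IsDownlinkNetwork μ P v link pat fad)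
    (hP : P.Admissible) {s : ℝ} (hs : 0 ≤ s) :
    condLaplace μ P v link pat fad s =ᵐ[μ] fun ω => expNeg (P.laplaceExponent s ‖v 0 ω‖) := by
  have hexp : Measurable fun t => expNeg (P.laplaceExponent s t) := by
    simp_rw [← toReal_eexpNeg]
    fun_prop
  have hint : Integrable (fun ω => expNeg (P.laplaceExponent s ‖v 0 ω‖)) μ := integrable_expNeg
    ((P.measurable_laplaceExponent s).comp (hnet.measurable_v 0).norm)
  refine (ae_eq_condExp_of_forall_setIntegral_eq (hnet.measurable_v 0).norm.comap_le
    (integrable_expNeg (hnet.measurable_interference.const_mul _))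
    (fun _ _ _ => hint.integrableOn) ?_
    (hexp.comp (comap_measurable _)).aestronglyMeasurable).symm
  rintro _ ⟨A, hA, rfl⟩ -
  exact (hnet.setIntegral_expNeg_interference hP hs hA).symm

end IsDownlinkNetwork

/-- The Laplace transform of the downlink interference conditional on the distance `r₁` of the
nearest UAV. If the NLOS exponent exceeds 2, all series converge and the closed form holds as it
stands; in all cases, the NLOS exponent 2 (where the NLOS series may diverge to `+∞`) included, it
holds with the series read as limits of partial sums and `exp (-∞) = 0`. -/
theorem lemma1 {Ω : Type*} [MeasurableSpace Ω] (μ : Measure Ω) [IsProbabilityMeasure μ]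
    (P : DownlinkParams) (hP : P.Admissible) (hα : ∀ κ, 2 ≤ P.α κ)
    (v : ℕ → Ω → EuclideanSpace ℝ (Fin 2)) (link : ℕ → Ω → Link) (pat : ℕ → Ω → Fin 4)
    (fad : ℕ → Ω → ℝ) (hnet : IsDownlinkNetwork μ P v link pat fad)
    (s : ℝ) (hs : 0 ≤ s) :
    (∀ (i : Fin 4) (r₁ : ℝ), 0 < r₁ →
      Summable (fun m : ℕ => P.thetaTerm Link.L s (P.gain i) (P.γ r₁ + 1 + m)) ∧
      (2 < P.α Link.N →
        Summable (fun m : ℕ => P.thetaTerm Link.N s (P.gain i) (P.γ r₁ + 1 + m)))) ∧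
    (2 < P.α Link.N →
      ∀ᵐ ω ∂μ, condLaplace μ P v link pat fad s ω =
        Real.exp (-2 * Real.pi * P.lam * ∑ i : Fin 4, P.gainProb i *
          (P.Theta Link.L s (P.gain i) ‖v 0 ω‖ + P.Theta Link.N s (P.gain i) ‖v 0 ω‖))) ∧
    (∀ᵐ ω ∂μ, Tendsto
      (fun J : ℕ => Real.exp (-2 * Real.pi * P.lam * ∑ i : Fin 4, P.gainProb i *
        (P.ThetaPartial J Link.L s (P.gain i) ‖v 0 ω‖
          + P.ThetaPartial J Link.N s (P.gain i) ‖v 0 ω‖)))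
      atTop (𝓝 (condLaplace μ P v link pat fad s ω))) := by
  have hL (i : Fin 4) : Summable (P.thetaTerm Link.L s (P.gain i)) :=
    hP.summable_thetaTerm_L (hα _) hs (hP.gain_nonneg i)
  have hN (hα : 2 < P.α Link.N) (i : Fin 4) : Summable (P.thetaTerm Link.N s (P.gain i)) :=
    hP.summable_thetaTerm_of_two_lt hα hs (hP.gain_nonneg i)
  have hlim : ∀ᵐ ω ∂μ, Tendsto
      (fun J : ℕ => Real.exp (-2 * Real.pi * P.lam * ∑ i : Fin 4, P.gainProb i *
        (P.ThetaPartial J Link.L s (P.gain i) ‖v 0 ω‖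
          + P.ThetaPartial J Link.N s (P.gain i) ‖v 0 ω‖)))
      atTop (𝓝 (condLaplace μ P v link pat fad s ω)) := by
    filter_upwards [hnet.condLaplace_ae_eq hP hs, hnet.ae_norm_nearest_pos] with ω hω hpos
    rw [hω]
    exact hP.tendsto_exp_sum_ThetaPartial hα hs hpos
  refine ⟨fun i _ _ => ⟨(hL i).comp_injective (add_right_injective _),
    fun h => (hN h i).comp_injective (add_right_injective _)⟩, fun h => ?_, hlim⟩
  filter_upwards [hlim] with ω hω
  exact tendsto_nhds_unique hω <| (Real.continuous_exp.tendsto _).comp <|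
    (tendsto_finsetSum _ fun i _ => ((DownlinkParams.tendsto_ThetaPartial (hL i) _).add
      (DownlinkParams.tendsto_ThetaPartial (hN h i) _)).const_mul _).const_mul _
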